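/- Let $m\ge 0$, let $\theta$ be a real skew-symmetric $m\times m$ matrix and put $\rho_{ij}=\exp(2\pi i\,\theta_{ij})$. All C*-algebras, and all C*-subalgebras generated by a set, are unital. Let $A_\theta$ be the universal C*-algebra generated by unitaries $U_1,\dots,U_m$ subject to $U_iU_j=\rho_{ji}U_jU_i$, and let the $\theta$-deformed ball $C(D^{2m}_\theta)$ be the universal C*-algebra generated by normal elements $w_1,\dots,w_m$ and a positive element $y$ subject to $$w_1w_1^*+\dots+w_mw_m^*+y^2=1,\qquad w_iw_j=\rho_{ji}w_jw_i,\qquad yw_i=w_iy .$$ Let $S^m_+=\{(t_1,\dots,t_{m+1})\in\mathbb R^{m+1}: \sum_k t_k^2=1,\ t_k\ge 0 \text{ for all } k\le m+1\}$ and, for $i\le m$, let $S(i)=\{t\in S^m_+ : t_i=0\}$ and let $A_\theta(i)$ be the C*-subalgebra of $A_\theta$ generated by $\{U_j : j\ne i\}$. Let $\mathbb A$ be the C*-subalgebra of $C(S^m_+,A_\theta)$ consisting of the continuous functions $f$ with $f(S(i))\subseteq A_\theta(i)$ for all $i\le m$. Then $C(D^{2m}_\theta)\cong\mathbb A$ as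 C*-algebras. -/

import Mathlib

open scoped ENNReal Matrix CStarAlgebra

noncomputable section

/-! ### Universal C*-algebras given by generators and relations -/

/-- Generators indexed by `X`, together with relations: for a family `a : X → A` in a unital
C*-algebra `A`, `Holds a` says that `a` satisfies the relations. The relations must bound the norm
of each generator, uniformly over all C*-algebras. -/
structure CStarRelations (X : Type) where
  Holds : ∀ {A : Type} [CStarAlgebra A], (X → A) → Prop
  bound : X → ℝ
  norm_le : ∀ {A : Type} [CStarAlgebra A] {a : X → A}, Holds a → ∀ x, ‖a x‖ ≤ bound x

/-- Evaluation of a noncommutative polynomial in the letters `x, x*` (`x ∈ X`) at a family of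
elements of a C*-algebra: the letter `Sum.inl x` becomes `a x`, and `Sum.inr x` becomes
`star (a x)`. -/
def starEval {X A : Type} [CStarAlgebra A] (a : X → A) : FreeAlgebra ℂ (X ⊕ X) →ₐ[ℂ] A :=
  FreeAlgebra.lift ℂ (Sum.elim a fun x => star (a x))

/-- The unital C*-subalgebra of a C*-algebra generated by a set. -/
def cstarGenerate {A : Type} [CStarAlgebra A] (s : Set A) : StarSubalgebra ℂ A :=
  (StarAlgebra.adjoin ℂ s).topologicalClosure

instance isClosed_cstarGenerate {A : Type} [CStarAlgebra A] (s : Set A) :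
    IsClosed (cstarGenerate s : Set A) :=
  StarSubalgebra.isClosed_topologicalClosure _

namespace CStarRelations

variable {X : Type} (R : CStarRelations X)

/-- The norm functions `f ↦ ‖f(a, a*)‖` on noncommutative *-polynomials that come from families
`a` in some nonzero C*-algebra that satisfy the relations. -/
def Rep : Type :=
  {N : FreeAlgebra ℂ (X ⊕ X) → ℝ // ∃ (A : Type) (_ : CStarAlgebra A) (_ : Nontrivial A)
    (a : X → A), R.Holds a ∧ ∀ f, N f = ‖starEval a f‖}

/-- A C*-algebra containing a family with the given norm function. -/
def Carrier (i : R.Rep) : Type := i.2.choose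

instance (i : R.Rep) : CStarAlgebra (R.Carrier i) := i.2.choose_spec.choose

instance (i : R.Rep) : Nontrivial (R.Carrier i) := i.2.choose_spec.choose_spec.choose

/-- A family of elements that satisfies the relations and has the given norm function. -/
def fam (i : R.Rep) : X → R.Carrier i := i.2.choose_spec.choose_spec.choose_spec.choose

theorem holds_fam (i : R.Rep) : R.Holds (R.fam i) :=
  i.2.choose_spec.choose_spec.choose_spec.choose_spec.1

theorem norm_starEval_fam (i : R.Rep) (f : FreeAlgebra ℂ (X ⊕ X)) :
    i.1 f = ‖starEval (R.fam i) f‖ :=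
  i.2.choose_spec.choose_spec.choose_spec.choose_spec.2 f

/-- The C*-algebra of bounded families in the product of all the representing C*-algebras. -/
abbrev Product : Type := lp R.Carrier ∞

instance : CStarAlgebra R.Product where

/-- The generators, placed diagonally in the product. -/
def diag (x : X) : R.Product :=
  ⟨fun i => R.fam i x, memℓp_infty ⟨R.bound x, by
    rintro _ ⟨i, rfl⟩
    exact R.norm_le (R.holds_fam i) x⟩⟩

/-- The universal unital C*-algebra on generators `X` subject to the relations `R`: the completion
of the algebra of noncommutative *-polynomials in the supremum of the seminorms
`f ↦ ‖f(a, a*)‖`, over all families `a` satisfying the relations. -/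
def Universal : Type := cstarGenerate (Set.range R.diag)

instance : CStarAlgebra R.Universal :=
  inferInstanceAs (CStarAlgebra (cstarGenerate (Set.range R.diag)))

/-- The generators of the universal C*-algebra. -/
def gen (x : X) : R.Universal :=
  ⟨R.diag x, StarSubalgebra.le_topologicalClosure _ (StarAlgebra.subset_adjoin ℂ _ ⟨x, rfl⟩)⟩

/-- Evaluation of the universal C*-algebra at one of the families defining it. -/
def evalAt (i : R.Rep) : R.Universal →⋆ₐ[ℂ] R.Carrier i where
  toFun u := u.1 i
  map_one' := rfl
  map_mul' _ _ := rfl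
  map_zero' := rfl
  map_add' _ _ := rfl
  commutes' _ := rfl
  map_star' _ := rfl

theorem evalAt_gen (i : R.Rep) (x : X) : R.evalAt i (R.gen x) = R.fam i x := rfl

theorem ext_evalAt {u v : R.Universal} (h : ∀ i, R.evalAt i u = R.evalAt i v) : u = v :=
  Subtype.ext (lp.ext (funext h))

theorem norm_le_of_evalAt {u : R.Universal} {C : ℝ} (hC : 0 ≤ C)
    (h : ∀ i, ‖R.evalAt i u‖ ≤ C) : ‖u‖ ≤ C :=
  lp.norm_le_of_forall_le hC h

theorem exists_starEval {A : Type} [CStarAlgebra A] (c : X → A) {z : A}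
    (hz : z ∈ StarAlgebra.adjoin ℂ (Set.range c)) : ∃ f, starEval c f = z := by
  have h : Algebra.adjoin ℂ (Set.range c ∪ star (Set.range c)) ≤ (starEval c).range := by
    refine Algebra.adjoin_le ?_
    rintro z (⟨x, rfl⟩ | ⟨x, hx⟩)
    · exact ⟨FreeAlgebra.ι ℂ (Sum.inl x), by simp [starEval]⟩
    · exact ⟨FreeAlgebra.ι ℂ (Sum.inr x), by simp [starEval, hx]⟩
  exact h hz

theorem hom_ext {B : Type} [CStarAlgebra B] {φ ψ : R.Universal →⋆ₐ[ℂ] B}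
    (h : ∀ x, φ (R.gen x) = ψ (R.gen x)) : φ = ψ := by
  refine StarAlgHom.ext_topologicalClosure
    (S := StarAlgebra.adjoin ℂ (Set.range R.diag)) (map_continuous φ) (map_continuous ψ) ?_
  refine StarAlgHom.ext_adjoin ?_
  rintro ⟨_, _⟩ ⟨x, rfl⟩
  exact h x

/-- The universal property: every family satisfying the relations is the image of the generators
under a unique unital *-homomorphism. -/
theorem existsUnique_lift {B : Type} [CStarAlgebra B] (b : X → B) (hb : R.Holds b) :
    ∃! φ : R.Universal →⋆ₐ[ℂ] B, ∀ x, φ (R.gen x) = b x := by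
  suffices h : ∃ φ : R.Universal →⋆ₐ[ℂ] B, ∀ x, φ (R.gen x) = b x by
    obtain ⟨φ, hφ⟩ := h
    exact ⟨φ, hφ, fun ψ hψ => R.hom_ext fun x => (hψ x).trans (hφ x).symm⟩
  rcases subsingleton_or_nontrivial B with hB | hB
  · exact ⟨{ toFun := 0, map_one' := Subsingleton.elim _ _, map_mul' := by simp, map_zero' := rfl,
             map_add' := by simp, commutes' := fun _ => Subsingleton.elim _ _,
             map_star' := by simp }, fun _ => Subsingleton.elim _ _⟩
  let i : R.Rep := ⟨fun f => ‖starEval b f‖, B, inferInstance, hB, b, hb, fun _ => rfl⟩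
  let c : X → R.Carrier i × B := fun x => (R.fam i x, b x)
  let D := cstarGenerate (Set.range c)
  have hD : ∀ d ∈ D, ‖d.1‖ = ‖d.2‖ := by
    intro d hd
    refine closure_minimal (t := {d : R.Carrier i × B | ‖d.1‖ = ‖d.2‖}) ?_ ?_ hd
    · intro z hz
      obtain ⟨f, rfl⟩ := exists_starEval c hz
      have h1 : (starEval c f).1 = starEval (R.fam i) f := by
        refine DFunLike.congr_fun (f := (AlgHom.fst ℂ _ _).comp (starEval c)) ?_ f
        ext (x | x) <;> simp [starEval, c]
      have h2 : (starEval c f).2 = starEval b f := by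
        refine DFunLike.congr_fun (f := (AlgHom.snd ℂ _ _).comp (starEval c)) ?_ f
        ext (x | x) <;> simp [starEval, c]
      show ‖_‖ = ‖_‖
      rw [h1, h2, ← R.norm_starEval_fam]
    · exact isClosed_eq (by fun_prop) (by fun_prop)
  have huniq : ∀ d ∈ D, ∀ e ∈ D, d.1 = e.1 → d.2 = e.2 := by
    intro d hd e he h
    have := hD _ (sub_mem hd he)
    simp only [Prod.fst_sub, Prod.snd_sub, h, sub_self, norm_zero] at this
    exact sub_eq_zero.1 (norm_eq_zero.1 this.symm)
  have hex : ∀ u : R.Universal, ∃ d ∈ D, d.1 = R.evalAt i u := by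
    have hcl : IsClosed (Prod.fst '' (D : Set (R.Carrier i × B))) := by
      have hiso : Isometry fun d : D => d.1.1 := by
        refine Isometry.of_dist_eq fun d e => ?_
        have := hD _ (sub_mem d.2 e.2)
        rw [Subtype.dist_eq, dist_eq_norm, dist_eq_norm, Prod.norm_def, ← this, max_self]
        rfl
      have hc : IsClosed (D : Set (R.Carrier i × B)) := isClosed_cstarGenerate _
      have := hc.completeSpace_coe
      have h := hiso.isClosedEmbedding.isClosed_range
      convert h using 1
      ext z; simp
    let E : StarSubalgebra ℂ (R.Carrier i) := D.map (StarAlgHom.fst ℂ _ _)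
    have hE : IsClosed (E : Set (R.Carrier i)) := hcl
    intro u
    suffices h : R.evalAt i u ∈ E from h
    have hden : DenseRange (StarSubalgebra.inclusion
        (StarSubalgebra.le_topologicalClosure (StarAlgebra.adjoin ℂ (Set.range R.diag)))) :=
      (denseRange_inclusion_iff
        (StarSubalgebra.le_topologicalClosure (StarAlgebra.adjoin ℂ (Set.range R.diag)))).2
          subset_rfl
    refine hden.induction_on (p := fun u => R.evalAt i u ∈ E) u
      (hE.preimage (map_continuous (R.evalAt i))) ?_
    intro a
    refine StarAlgebra.adjoin_induction_subtype (p := fun a => R.evalAt i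
      (StarSubalgebra.inclusion (StarSubalgebra.le_topologicalClosure _) a) ∈ E) a ?_ ?_ ?_ ?_ ?_
    · rintro _ ⟨x, rfl⟩
      exact ⟨c x, StarSubalgebra.le_topologicalClosure _ (StarAlgebra.subset_adjoin ℂ _ ⟨x, rfl⟩),
        rfl⟩
    · intro r
      exact algebraMap_mem E r
    · intro x y hx hy
      exact add_mem hx hy
    · intro x y hx hy
      exact mul_mem hx hy
    · intro x hx
      exact star_mem hx
  choose d hd hd' using hex
  refine ⟨{ toFun := fun u => (d u).2, map_one' := ?_, map_mul' := ?_, map_zero' := ?_,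
            map_add' := ?_, commutes' := ?_, map_star' := ?_ }, ?_⟩
  · exact huniq _ (hd _) 1 (one_mem D) (by simp [hd'])
  · intro u v
    exact huniq _ (hd _) _ (mul_mem (hd u) (hd v)) (by simp [hd'])
  · exact huniq _ (hd _) 0 (zero_mem D) (by simp [hd'])
  · intro u v
    exact huniq _ (hd _) _ (add_mem (hd u) (hd v)) (by simp [hd'])
  · intro r
    exact huniq _ (hd _) _ (algebraMap_mem D r) ((hd' _).trans ((R.evalAt i).commutes r))
  · intro u
    exact huniq _ (hd _) _ (star_mem (hd u)) (by simp [hd', map_star])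
  · intro x
    refine huniq _ (hd _) (c x)
      (StarSubalgebra.le_topologicalClosure _ (StarAlgebra.subset_adjoin ℂ _ ⟨x, rfl⟩)) ?_
    rw [hd']; rfl

end CStarRelations

/-! ### Deformed tori and balls -/

/-- `ρ i j = exp (2 π i θ i j)`. -/
def rho {m : ℕ} (θ : Matrix (Fin m) (Fin m) ℝ) (i j : Fin m) : ℂ :=
  Complex.exp (2 * Real.pi * Complex.I * θ i j)

/-- Unitaries `U i` with `U i U j = ρ j i • U j U i`. -/
structure IsTorusFamily {m : ℕ} (θ : Matrix (Fin m) (Fin m) ℝ) {A : Type*} [CStarAlgebra A]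
    (U : Fin m → A) : Prop where
  unitary : ∀ i, U i ∈ unitary A
  comm : ∀ i j, U i * U j = rho θ j i • (U j * U i)

/-- Normal elements `w i` and a positive element `y` with `∑ w i (w i)* + y ^ 2 = 1`,
`w i w j = ρ j i • w j w i` and `y w i = w i y`. -/
structure IsBallFamily {m : ℕ} (θ : Matrix (Fin m) (Fin m) ℝ) {A : Type*} [CStarAlgebra A]
    (w : Fin m → A) (y : A) : Prop where
  normal : ∀ i, IsStarNormal (w i)
  positive : ∃ b, y = star b * b
  sphere : ∑ i, w i * star (w i) + y ^ 2 = 1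
  comm : ∀ i j, w i * w j = rho θ j i • (w j * w i)
  central : ∀ i, y * w i = w i * y

theorem norm_le_one_of_mem_unitary {A : Type*} [CStarAlgebra A] {u : A} (hu : u ∈ unitary A) :
    ‖u‖ ≤ 1 := by
  rcases subsingleton_or_nontrivial A with h | h
  · simp [Subsingleton.elim u 0]
  · exact (CStarRing.norm_of_mem_unitary hu).le

theorem norm_le_one_of_mul_star_self_le {A : Type*} [CStarAlgebra A] [PartialOrder A]
    [StarOrderedRing A] {a : A} (h : a * star a ≤ 1) : ‖a‖ ≤ 1 := by
  have h2 := (CStarAlgebra.norm_le_one_iff_of_nonneg (a * star a) (mul_star_self_nonneg a)).2 h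
  rw [CStarRing.norm_self_mul_star] at h2
  nlinarith [norm_nonneg a]

namespace IsBallFamily

variable {m : ℕ} {θ : Matrix (Fin m) (Fin m) ℝ} {A : Type*} [CStarAlgebra A]
  {w : Fin m → A} {y : A}

theorem star_y (h : IsBallFamily θ w y) : star y = y := by
  obtain ⟨b, rfl⟩ := h.positive
  simp

theorem norm_w_le (h : IsBallFamily θ w y) (i : Fin m) : ‖w i‖ ≤ 1 := by
  let _ := CStarAlgebra.spectralOrder A
  have := CStarAlgebra.spectralOrderedRing A
  apply norm_le_one_of_mul_star_self_le
  rw [← h.sphere]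
  have h1 : w i * star (w i) ≤ ∑ j, w j * star (w j) :=
    Finset.single_le_sum (f := fun j => w j * star (w j))
      (fun j _ => mul_star_self_nonneg (w j)) (Finset.mem_univ i)
  have h2 : 0 ≤ y ^ 2 := by
    have := mul_star_self_nonneg y
    rwa [h.star_y, ← sq] at this
  exact h1.trans (le_add_of_nonneg_right h2)

theorem norm_y_le (h : IsBallFamily θ w y) : ‖y‖ ≤ 1 := by
  let _ := CStarAlgebra.spectralOrder A
  have := CStarAlgebra.spectralOrderedRing A
  apply norm_le_one_of_mul_star_self_le
  rw [h.star_y, ← sq, ← h.sphere]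
  exact le_add_of_nonneg_left (Finset.sum_nonneg fun j _ => mul_star_self_nonneg (w j))

end IsBallFamily

/-- The generators and relations of the noncommutative torus. -/
def torusRelations {m : ℕ} (θ : Matrix (Fin m) (Fin m) ℝ) : CStarRelations (Fin m) where
  Holds U := IsTorusFamily θ U
  bound _ := 1
  norm_le h i := norm_le_one_of_mem_unitary (h.unitary i)

/-- The generators and relations of the deformed ball: `some i` stands for the generator `w i`,
and `none` for the generator `y`. -/
def ballRelations {m : ℕ} (θ : Matrix (Fin m) (Fin m) ℝ) : CStarRelations (Option (Fin m)) where
  Holds a := IsBallFamily θ (fun i => a (some i)) (a none)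
  bound _ := 1
  norm_le h x := by
    cases x with
    | none => exact h.norm_y_le
    | some i => exact h.norm_w_le i

/-- The `θ`-deformed `m`-torus `A_θ`. -/
abbrev DeformedTorus {m : ℕ} (θ : Matrix (Fin m) (Fin m) ℝ) : Type := (torusRelations θ).Universal

/-- The canonical unitary generators `U i` of `A_θ`. -/
def torusU {m : ℕ} (θ : Matrix (Fin m) (Fin m) ℝ) (i : Fin m) : DeformedTorus θ :=
  (torusRelations θ).gen i

/-- The `θ`-deformed `2m`-ball `C(D^{2m}_θ)`. -/
abbrev DeformedBall {m : ℕ} (θ : Matrix (Fin m) (Fin m) ℝ) : Type := (ballRelations θ).Universal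

/-- The generators of the deformed torus satisfy its defining relations. -/
theorem isTorusFamily_torusU {m : ℕ} (θ : Matrix (Fin m) (Fin m) ℝ) :
    IsTorusFamily θ (torusU θ) := by
  have h := (torusRelations θ).holds_fam
  refine ⟨fun j => Unitary.mem_iff.2 ⟨?_, ?_⟩, fun j k => ?_⟩ <;>
    refine (torusRelations θ).ext_evalAt fun i => ?_
  · simpa [torusU, CStarRelations.evalAt_gen, map_star] using (Unitary.mem_iff.1 ((h i).unitary j)).1
  · simpa [torusU, CStarRelations.evalAt_gen, map_star] using (Unitary.mem_iff.1 ((h i).unitary j)).2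
  · simpa [torusU, CStarRelations.evalAt_gen] using (h i).comm j k

/-- The generators of the deformed ball satisfy its defining relations. -/
theorem isBallFamily_gen {m : ℕ} (θ : Matrix (Fin m) (Fin m) ℝ) :
    IsBallFamily θ (fun i => (ballRelations θ).gen (some i)) ((ballRelations θ).gen none) := by
  set R := ballRelations θ
  have h : ∀ i, IsBallFamily θ (fun j => R.fam i (some j)) (R.fam i none) := R.holds_fam
  refine ⟨fun j => ⟨R.ext_evalAt fun i => ?_⟩, ?_, R.ext_evalAt fun i => ?_,
    fun j k => R.ext_evalAt fun i => ?_, fun j => R.ext_evalAt fun i => ?_⟩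
  · simpa [R.evalAt_gen, map_star] using ((h i).normal j).star_comm_self.eq
  · have hsa : IsSelfAdjoint (R.gen none) := R.ext_evalAt fun i => by
      simpa [R.evalAt_gen, map_star] using (h i).star_y
    have hn : ‖R.gen none‖ ≤ 1 := R.norm_le_of_evalAt zero_le_one fun i => (h i).norm_y_le
    let _ := CStarAlgebra.spectralOrder R.Universal
    have := CStarAlgebra.spectralOrderedRing R.Universal
    rw [← CStarAlgebra.nonneg_iff_eq_star_mul_self,
      nonneg_iff_isSelfAdjoint_and_quasispectrumRestricts,
      quasispectrumRestricts_iff_spectrumRestricts]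
    refine ⟨hsa, (SpectrumRestricts.nnreal_iff_nnnorm (t := 1) hsa hn).2 ?_⟩
    refine R.norm_le_of_evalAt zero_le_one fun i => ?_
    have hi : SpectrumRestricts (R.fam i none) ContinuousMap.realToNNReal := by
      obtain ⟨b, hb⟩ := (h i).positive
      rw [hb, SpectrumRestricts.nnreal_iff]
      exact spectrum_star_mul_self_nonneg
    have := (SpectrumRestricts.nnreal_iff_nnnorm (t := 1) (h i).star_y (h i).norm_y_le).1 hi
    simpa [R.evalAt_gen, ← NNReal.coe_le_coe] using this
  · simpa [R.evalAt_gen, map_star] using (h i).sphere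
  · simpa [R.evalAt_gen] using (h i).comm j k
  · simpa [R.evalAt_gen] using (h i).central j

/-- The unital C*-subalgebra `A_θ(i)` of `A_θ` generated by the `U j` with `j ≠ i`. -/
def torusFace {m : ℕ} (θ : Matrix (Fin m) (Fin m) ℝ) (i : Fin m) :
    StarSubalgebra ℂ (DeformedTorus θ) :=
  cstarGenerate (torusU θ '' {j | j ≠ i})

/-! ### The algebra of functions on the octant -/

/-- The octant `S^m_+` of the unit sphere of `ℝ^(m+1)`. -/
def sphereOctant (m : ℕ) : Set (EuclideanSpace ℝ (Fin (m + 1))) :=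
  {t | t ∈ Metric.sphere 0 1 ∧ ∀ k, 0 ≤ t k}

instance (m : ℕ) : CompactSpace (sphereOctant m) := by
  rw [← isCompact_iff_compactSpace]
  have h : IsClosed {t : EuclideanSpace ℝ (Fin (m + 1)) | ∀ k, 0 ≤ t k} := by
    simp only [Set.ofPred_forall]
    exact isClosed_iInter fun k => isClosed_le continuous_const (by fun_prop)
  exact (isCompact_sphere _ _).inter_right h

/-- The C*-algebra of continuous functions `f : S^m_+ → A_θ` such that, for every `i ≤ m`,
`f` maps the face `t i = 0` into `A_θ(i)`. The coordinates `t 1, …, t m` are indexed by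
`Fin.castSucc i`, `i : Fin m`; there is no condition at the last coordinate. -/
def fieldAlgebra {m : ℕ} (θ : Matrix (Fin m) (Fin m) ℝ) :
    StarSubalgebra ℂ C(sphereOctant m, DeformedTorus θ) where
  carrier := {f | ∀ (i : Fin m) (t : sphereOctant m), t.1 i.castSucc = 0 → f t ∈ torusFace θ i}
  mul_mem' hf hg i t ht := mul_mem (hf i t ht) (hg i t ht)
  add_mem' hf hg i t ht := add_mem (hf i t ht) (hg i t ht)
  algebraMap_mem' r i _ _ := algebraMap_mem (torusFace θ i) r
  star_mem' hf i t ht := star_mem (hf i t ht)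

instance isClosed_fieldAlgebra {m : ℕ} (θ : Matrix (Fin m) (Fin m) ℝ) :
    IsClosed (fieldAlgebra θ : Set C(sphereOctant m, DeformedTorus θ)) := by
  have h : (fieldAlgebra θ : Set C(sphereOctant m, DeformedTorus θ)) =
      ⋂ (i : Fin m) (t : sphereOctant m) (_ : t.1 i.castSucc = 0),
        {f | f t ∈ (torusFace θ i : Set (DeformedTorus θ))} := by
    ext f; simp [fieldAlgebra]
  rw [h]
  refine isClosed_iInter fun i => isClosed_iInter fun t => isClosed_iInter fun _ => ?_
  exact (isClosed_cstarGenerate _).preimage (continuous_eval_const t)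

end

noncomputable section

/-! ### The deformed torus is not zero -/

section WeightedPermutation

variable {ι : Type*} [DecidableEq ι] (σ : Equiv.Perm ι) (c : ι → Circle)

/-! The isomorphism sends `w i` to the function `t ↦ t i • U i` and `y` to the last coordinate.

Injectivity: the torus `T^m` acts on both sides by rotating generators, and the map is equivariant.
The gauge-invariant part of the ball is the commutative C*-algebra generated by `y` and the `w i *
star (w i)`. Because of the sphere relation its characters are evaluations at points of the octant,
so the map is isometric there (`norm_le_norm_ballMap`); this needs `‖1‖ = 1` in `A_θ`, hence the
operators on `ℓ²(ℤ^m)`. A positive element of the kernel has averages in the kernel, and averaging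
is faithful on positive elements. Instead of Haar measure, finite means over `N`-torsion points are
used: they are contractive, for large `N` they kill every unbalanced word
(`gaugeAverage_prod_eq_zero`), and they satisfy `‖a‖ ≤ C * ‖E_N a‖` for positive `a` with `C`
independent of `N` (`exists_norm_le_mul_norm_gaugeAverage`).

Surjectivity: the range is closed because an injective *-homomorphism is isometric. By
Stone–Weierstrass it contains all scalar functions, so by a partition of unity only pointwise
approximation is needed. At `t` the range contains the algebra generated by the `U j` with `t j ≠
0`, while a field takes its value in the intersection of the faces `A_θ(i)` with `t i = 0`. These
agree up to closure, again by averaging (`mem_cstarGenerate_of_forall_mem_torusFace`). -/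

theorem inner_smul_single (k : ι) (x : lp (fun _ : ι => ℂ) 2) :
    inner ℂ ((c k : ℂ) • (lp.single 2 (σ k) (1 : ℂ) : lp (fun _ : ι => ℂ) 2)) x =
      star (c k : ℂ) * x (σ k) := by
  rw [inner_smul_left, lp.inner_single_left]
  simp

/-- The unitary operator on `ℓ²(ι)` that maps the basis vector `k` to `c k` times the basis vector
`σ k`. -/
def weightedPermutation : lp (fun _ : ι => ℂ) 2 ≃ₗᵢ[ℂ] lp (fun _ : ι => ℂ) 2 :=
  (HilbertBasis.mkOfOrthogonalEqBot
    (v := fun k => (c k : ℂ) • (lp.single 2 (σ k) (1 : ℂ) : lp (fun _ : ι => ℂ) 2))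
    (by
      rw [orthonormal_iff_ite]
      intro i j
      rw [inner_smul_single]
      by_cases h : i = j
      · subst h
        simp [← Complex.normSq_eq_conj_mul_self, Complex.normSq_eq_norm_sq, Circle.norm_coe]
      · simp [h])
    (by
      rw [Submodule.eq_bot_iff]
      intro x hx
      rw [Submodule.mem_orthogonal] at hx
      ext k
      have := hx _ (Submodule.subset_span ⟨σ.symm k, rfl⟩)
      rw [inner_smul_single] at this
      simpa using this)).repr.symm

theorem weightedPermutation_single (k : ι) :
    weightedPermutation σ c (lp.single 2 k (1 : ℂ)) = (c k : ℂ) • lp.single 2 (σ k) (1 : ℂ) := by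
  refine (HilbertBasis.repr_symm_single _ k).trans ?_
  rw [HilbertBasis.coe_mkOfOrthogonalEqBot]

/-- The weighted permutation as a unitary element of the algebra of operators. -/
def weightedPermutationOp : lp (fun _ : ι => ℂ) 2 →L[ℂ] lp (fun _ : ι => ℂ) 2 :=
  (Unitary.linearIsometryEquiv.symm (weightedPermutation σ c) : _ →L[ℂ] _)

theorem weightedPermutationOp_mem_unitary :
    weightedPermutationOp σ c ∈ unitary (lp (fun _ : ι => ℂ) 2 →L[ℂ] lp (fun _ : ι => ℂ) 2) :=
  (Unitary.linearIsometryEquiv.symm (weightedPermutation σ c)).2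

theorem weightedPermutationOp_single (k : ι) :
    weightedPermutationOp σ c (lp.single 2 k (1 : ℂ)) = (c k : ℂ) • lp.single 2 (σ k) (1 : ℂ) :=
  weightedPermutation_single σ c k

theorem weightedPermutationOp_mul_eq {τ : Equiv.Perm ι} {d : ι → Circle} {z : ℂ}
    (hσ : ∀ k, σ (τ k) = τ (σ k)) (h : ∀ k, (d k : ℂ) * c (τ k) = z * (c k * d (σ k))) :
    weightedPermutationOp σ c * weightedPermutationOp τ d =
      z • (weightedPermutationOp τ d * weightedPermutationOp σ c) := by
  refine lp.ext_continuousLinearMap (p := 2) (by simp) fun k => ?_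
  ext1
  have key : (weightedPermutationOp σ c * weightedPermutationOp τ d) (lp.single 2 k (1 : ℂ)) =
      (z • (weightedPermutationOp τ d * weightedPermutationOp σ c)) (lp.single 2 k (1 : ℂ)) := by
    simp only [mul_apply_eq_comp, smul_apply,
      weightedPermutationOp_single, map_smul, smul_smul, hσ, h]
  simpa using key

end WeightedPermutation

/-- The phases of the weighted shifts representing the deformed torus. -/
def latticePhase {m : ℕ} (θ : Matrix (Fin m) (Fin m) ℝ) (i : Fin m) (k : Fin m → ℤ) : Circle :=
  Circle.exp (Real.pi * ∑ l, θ l i * k l)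

theorem latticePhase_add_single {m : ℕ} (θ : Matrix (Fin m) (Fin m) ℝ) (i j : Fin m)
    (k : Fin m → ℤ) :
    latticePhase θ i (k + Pi.single j 1) =
      latticePhase θ i k * Circle.exp (Real.pi * θ j i) := by
  rw [latticePhase, latticePhase, ← Circle.exp_add]
  congr 1
  simp [mul_add, Finset.sum_add_distrib, Pi.single_apply]

/-- The `i`-th shift of the lattice is weighted by a phase with the half angle `π`. Interchanging
two weighted shifts then costs `exp (π i (θ j i - θ i j))`, which is `rho θ j i` by skew-symmetry.
-/
theorem exists_isTorusFamily {m : ℕ} (θ : Matrix (Fin m) (Fin m) ℝ) (hθ : θᵀ = -θ) :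
    ∃ U : Fin m → (lp (fun _ : Fin m → ℤ => ℂ) 2 →L[ℂ] lp (fun _ : Fin m → ℤ => ℂ) 2),
      IsTorusFamily θ U := by
  refine ⟨fun i => weightedPermutationOp (Equiv.addRight (Pi.single i 1)) (latticePhase θ i),
    fun i => weightedPermutationOp_mem_unitary _ _, fun i j => ?_⟩
  refine weightedPermutationOp_mul_eq _ _ (fun k => by simp [add_right_comm]) fun k => ?_
  have hij : θ i j = -θ j i := by simpa using congrFun (congrFun hθ j) i
  have h : (Circle.exp (Real.pi * θ j i) : ℂ) = rho θ j i * Circle.exp (Real.pi * θ i j) := by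
    rw [rho, Circle.coe_exp, Circle.coe_exp, ← Complex.exp_add, hij]
    congr 1
    push_cast
    ring
  simp only [Equiv.coe_addRight, latticePhase_add_single, Circle.coe_mul, h]
  ring

/-- A unital homomorphism into a nonzero algebra has nonzero domain. Skew-symmetry enters the proof
of the theorem here; the conclusion gives `‖1‖ = 1`, so that scalar-valued functions keep their norm
in `A_θ`. -/
theorem nontrivial_deformedTorus {m : ℕ} (θ : Matrix (Fin m) (Fin m) ℝ) (hθ : θᵀ = -θ) :
    Nontrivial (DeformedTorus θ) := by
  obtain ⟨U, hU⟩ := exists_isTorusFamily θ hθ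
  obtain ⟨φ, -⟩ := (torusRelations θ).existsUnique_lift U hU
  have : Nontrivial (lp (fun _ : Fin m → ℤ => ℂ) 2) :=
    ⟨lp.single 2 0 1, 0, fun h => by simpa using congrArg (fun f => f.1 0) h⟩
  exact φ.toRingHom.domain_nontrivial

/-! ### Words in elements that commute up to scalars -/

/-- `a` and `b` commute up to a nonzero scalar. -/
def QuasiCommute {A : Type*} [Mul A] [SMul ℂ A] (a b : A) : Prop :=
  ∃ c : ℂ, c ≠ 0 ∧ a * b = c • (b * a)

namespace QuasiCommute

variable {A : Type*} [CStarAlgebra A] {a b : A}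

theorem of_commute (h : Commute a b) : QuasiCommute a b :=
  ⟨1, one_ne_zero, by rw [one_smul, h.eq]⟩

theorem symm (h : QuasiCommute a b) : QuasiCommute b a := by
  obtain ⟨c, hc, h⟩ := h
  exact ⟨c⁻¹, inv_ne_zero hc, by rw [h, smul_smul, inv_mul_cancel₀ hc, one_smul]⟩

theorem star_star (h : QuasiCommute a b) : QuasiCommute (star a) (star b) := by
  obtain ⟨c, hc, h⟩ := h.symm
  exact ⟨star c, star_ne_zero.2 hc, by simpa using congrArg star h⟩

/-- Fuglede–Putnam: `a * b = (c • b) * a` says that `a` intertwines the normal elements `b` and `c •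
b`, so it also intertwines their adjoints. -/
theorem star_right [IsStarNormal b] (h : QuasiCommute a b) : QuasiCommute a (star b) := by
  obtain ⟨c, hc, h⟩ := h
  have hn : IsStarNormal (c • b) :=
    ⟨by rw [star_smul]; exact (star_comm_self.smul_right c).smul_left (star c)⟩
  have := fuglede_putnam_rosenblum (a := b) (b := c • b) (x := a) ‹_› hn
    (by rw [SemiconjBy, h, smul_mul_assoc])
  refine ⟨star c, star_ne_zero.2 hc, ?_⟩
  rw [this.eq, star_smul, smul_mul_assoc]

theorem star_left [IsStarNormal a] (h : QuasiCommute a b) : QuasiCommute (star a) b :=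
  h.symm.star_right.symm

end QuasiCommute

/-- A permutation is built from adjacent swaps, each of which costs a scalar. Up to scalars, only
the letter counts of a word matter. -/
theorem List.Perm.exists_prod_map_eq_smul {X A : Type*} [CStarAlgebra A] {L : X → A}
    (hL : ∀ x y, QuasiCommute (L x) (L y)) {l l' : List X} (h : l.Perm l') :
    ∃ c : ℂ, (l.map L).prod = c • (l'.map L).prod := by
  induction h with
  | nil => exact ⟨1, by simp⟩
  | cons x _ ih =>
    obtain ⟨c, hc⟩ := ih
    exact ⟨c, by simp [hc]⟩
  | swap x y l =>
    obtain ⟨c, -, hc⟩ := hL y x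
    exact ⟨c, by simp only [List.map_cons, List.prod_cons, ← mul_assoc, hc, smul_mul_assoc]⟩
  | trans _ _ ih₁ ih₂ =>
    obtain ⟨c, hc⟩ := ih₁
    obtain ⟨d, hd⟩ := ih₂
    exact ⟨c * d, by rw [hc, hd, smul_smul]⟩

/-- Normal elements `w i` and a self-adjoint element `y`, such that the `w i` commute with each
other up to scalars, and with `y`. -/
structure IsQuasiCommutingFamily {ι A : Type*} [CStarAlgebra A] (w : ι → A) (y : A) : Prop where
  normal : ∀ i, IsStarNormal (w i)
  selfAdjoint : IsSelfAdjoint y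
  comm : ∀ i j, QuasiCommute (w i) (w j)
  central : ∀ i, Commute y (w i)

/-- The letter `none` stands for `y`, the letter `some (i, true)` for `w i` and the letter
`some (i, false)` for `star (w i)`. -/
def letter {ι A : Type*} [Star A] (w : ι → A) (y : A) : Option (ι × Bool) → A
  | none => y
  | some (i, true) => w i
  | some (i, false) => star (w i)

namespace IsQuasiCommutingFamily

variable {ι A : Type*} [CStarAlgebra A] {w : ι → A} {y : A}

theorem central_star (h : IsQuasiCommutingFamily w y) (i : ι) : Commute y (star (w i)) := by
  simpa [h.selfAdjoint.star_eq] using (h.central i).star_star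

theorem quasiCommute_letter (h : IsQuasiCommutingFamily w y) (a b : Option (ι × Bool)) :
    QuasiCommute (letter w y a) (letter w y b) := by
  have := h.normal
  match a, b with
  | none, none => exact .of_commute (Commute.refl _)
  | none, some (j, true) => exact .of_commute (h.central j)
  | none, some (j, false) => exact .of_commute (h.central_star j)
  | some (i, true), none => exact .of_commute (h.central i).symm
  | some (i, false), none => exact .of_commute (h.central_star i).symm
  | some (i, true), some (j, true) => exact h.comm i j
  | some (i, true), some (j, false) => exact (h.comm i j).star_right
  | some (i, false), some (j, true) => exact (h.comm i j).star_left
  | some (i, false), some (j, false) => exact (h.comm i j).star_star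

theorem adjoin_le_span_words (h : IsQuasiCommutingFamily w y) :
    Subalgebra.toSubmodule (StarAlgebra.adjoin ℂ (insert y (Set.range w))).toSubalgebra ≤
      Submodule.span ℂ (Set.range fun l : List (Option (ι × Bool)) => (l.map (letter w y)).prod) := by
  rw [StarAlgebra.adjoin_toSubalgebra, Algebra.adjoin_eq_span]
  refine Submodule.span_mono fun x hx => ?_
  obtain ⟨l, hl, rfl⟩ := Submonoid.exists_list_of_mem_closure hx
  have hl' : ∀ x ∈ l, ∃ a, letter w y a = x := by
    intro x hx
    have hx' := hl x hx
    rw [Set.mem_union, Set.mem_star] at hx'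
    obtain (h1 | ⟨i, hi⟩) | (h1 | ⟨i, hi⟩) := hx'
    · exact ⟨none, h1.symm⟩
    · exact ⟨some (i, true), hi⟩
    · exact ⟨none, by rw [← star_star x, h1, h.selfAdjoint.star_eq]; rfl⟩
    · exact ⟨some (i, false), by rw [← star_star x, ← hi]; rfl⟩
  obtain ⟨l', rfl⟩ : ∃ l' : List (Option (ι × Bool)), l'.map (letter w y) = l := by
    rw [← Set.mem_range, Set.range_list_map]
    exact hl'
  exact ⟨l', rfl⟩

/-- A word that is balanced in all letters `w i` with `i ∈ I` only involves these letters through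
the products `w i * star (w i)`. -/
theorem prod_mem_of_count_eq [DecidableEq ι] (h : IsQuasiCommutingFamily w y) {I : Finset ι}
    {S : Subalgebra ℂ A} (hy : y ∈ S) (hI : ∀ i ∈ I, w i * star (w i) ∈ S)
    (hw : ∀ i ∉ I, w i ∈ S) (hw' : ∀ i ∉ I, star (w i) ∈ S) (l : List (Option (ι × Bool)))
    (hl : ∀ i ∈ I, l.count (some (i, true)) = l.count (some (i, false))) :
    (l.map (letter w y)).prod ∈ S := by
  induction hn : l.length using Nat.strong_induction_on generalizing l with
  | _ n ih =>
    by_cases hex : ∃ i ∈ I, 0 < l.count (some (i, true))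
    · obtain ⟨i, hi, hpos⟩ := hex
      have h1 : some (i, true) ∈ l := List.count_pos_iff.1 hpos
      have h2 : some (i, false) ∈ l.erase (some (i, true)) := by
        rw [List.mem_erase_of_ne (by simp), ← List.count_pos_iff, ← hl i hi]
        exact hpos
      -- Balance supplies a partner for the letter `w i`. Moving the pair to the front costs a
      -- scalar and splits off `w i * star (w i)`; the remaining word is still balanced and shorter
      -- by two.
      have hp : l.Perm (some (i, true) :: some (i, false) ::
          (l.erase (some (i, true))).erase (some (i, false))) :=
        (List.perm_cons_erase h1).trans ((List.perm_cons_erase h2).cons _)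
      obtain ⟨c, hc⟩ := hp.exists_prod_map_eq_smul h.quasiCommute_letter
      rw [hc]
      refine S.smul_mem ?_ c
      rw [List.map_cons, List.map_cons, List.prod_cons, List.prod_cons, ← mul_assoc]
      refine S.mul_mem (hI i hi) (ih _ ?_ _ ?_ rfl)
      · have := hp.length_eq
        simp only [List.length_cons] at this
        omega
      · intro j hj
        have e1 := hl j hj
        rw [hp.count_eq, hp.count_eq] at e1
        by_cases hij : i = j
        · subst hij; simpa [List.count_cons] using e1
        · simpa [List.count_cons, hij] using e1
    -- No `w i` with `i ∈ I` occurs, and by balance no `star (w i)` either, so every letter lies in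
    -- `S`.
    · push Not at hex
      refine S.toSubsemiring.toSubmonoid.list_prod_mem fun x hx => ?_
      obtain ⟨a, ha, rfl⟩ := List.mem_map.1 hx
      match a with
      | none => exact hy
      | some (i, true) =>
        refine hw i fun hi => ?_
        have := List.count_pos_iff.2 ha
        have := hex i hi
        omega
      | some (i, false) =>
        refine hw' i fun hi => ?_
        have := List.count_pos_iff.2 ha
        have := hex i hi
        have := hl i hi
        omega

end IsQuasiCommutingFamily

/-! ### Gauge actions and averages over finite subgroups of the gauge group -/

/-- The point of the torus whose coordinates in `I` are the given roots of unity, and whose other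
coordinates are `1`. -/
def gaugePoint {ι : Type*} [DecidableEq ι] (I : Finset ι) {N : ℕ} [NeZero N] (j : ι → ZMod N) :
    ι → Circle :=
  fun i => if i ∈ I then ZMod.toCircle (j i) else 1

theorem gaugePoint_add {ι : Type*} [DecidableEq ι] (I : Finset ι) {N : ℕ} [NeZero N]
    (j k : ι → ZMod N) : gaugePoint I (j + k) = gaugePoint I j * gaugePoint I k := by
  ext i
  by_cases hi : i ∈ I <;> simp [gaugePoint, hi, AddChar.map_add_eq_mul]

/-- The scalar by which the gauge transformation `z` multiplies a letter. -/
def letterPhase {ι : Type*} (z : ι → Circle) : Option (ι × Bool) → ℂ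
  | none => 1
  | some (i, true) => z i
  | some (i, false) => star (z i : ℂ)

theorem letterPhase_mul {ι : Type*} (z z' : ι → Circle) (x : Option (ι × Bool)) :
    letterPhase (z * z') x = letterPhase z x * letterPhase z' x := by
  match x with
  | none => simp [letterPhase]
  | some (i, true) => simp [letterPhase]
  | some (i, false) => simp [letterPhase]

theorem prod_letterPhase_mul {ι : Type*} (z z' : ι → Circle) (l : List (Option (ι × Bool))) :
    (l.map (letterPhase (z * z'))).prod =
      (l.map (letterPhase z)).prod * (l.map (letterPhase z')).prod := by
  rw [← List.prod_map_mul]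
  exact congrArg List.prod (List.map_congr_left fun x _ => letterPhase_mul z z' x)

theorem prod_letterPhase_mulSingle {ι : Type*} [DecidableEq ι] (i : ι) (ζ : Circle)
    (l : List (Option (ι × Bool))) :
    (l.map (letterPhase (Pi.mulSingle i ζ))).prod =
      (ζ : ℂ) ^ l.count (some (i, true)) * star (ζ : ℂ) ^ l.count (some (i, false)) := by
  induction l with
  | nil => simp
  | cons x l ih =>
    rw [List.map_cons, List.prod_cons, ih]
    match x with
    | none => simp [letterPhase]
    | some (j, true) =>
      by_cases h : j = i
      · subst h; simp [letterPhase, pow_succ]; ring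
      · simp [letterPhase, h]
    | some (j, false) =>
      by_cases h : j = i
      · subst h; simp [letterPhase, pow_succ]; ring
      · simp [letterPhase, h]

theorem gaugePoint_single {ι : Type*} [DecidableEq ι] {I : Finset ι} {i : ι} (hi : i ∈ I)
    {N : ℕ} [NeZero N] (a : ZMod N) :
    gaugePoint I (Pi.single i a) = Pi.mulSingle i (ZMod.toCircle a) := by
  ext k
  by_cases hk : k = i
  · subst hk; simp [gaugePoint, hi]
  · simp [gaugePoint, hk]

/-- The phase is `ζ ^ p * star ζ ^ q` with `ζ` a primitive `N`-th root of unity and `p ≠ q` the two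
counts. Both are less than `N`, so `ζ ^ p ≠ ζ ^ q`. -/
theorem prod_letterPhase_gaugePoint_ne_one {ι : Type*} [DecidableEq ι] {I : Finset ι} {i : ι}
    (hi : i ∈ I) {l : List (Option (ι × Bool))}
    (h : l.count (some (i, true)) ≠ l.count (some (i, false))) {N : ℕ} [NeZero N]
    (hN : l.length < N) :
    (l.map (letterPhase (gaugePoint I (Pi.single i (1 : ZMod N))))).prod ≠ 1 := by
  rw [gaugePoint_single hi, prod_letterPhase_mulSingle]
  intro h1
  have hζ : star (ZMod.toCircle (1 : ZMod N) : ℂ) * (ZMod.toCircle (1 : ZMod N) : ℂ) = 1 := by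
    simp [← Complex.normSq_eq_conj_mul_self]
  have h2 : (ZMod.toCircle (1 : ZMod N) : ℂ) ^ l.count (some (i, true)) =
      (ZMod.toCircle (1 : ZMod N) : ℂ) ^ l.count (some (i, false)) := by
    have := congrArg (· * (ZMod.toCircle (1 : ZMod N) : ℂ) ^ l.count (some (i, false))) h1
    simpa only [mul_assoc, ← mul_pow, hζ, one_pow, mul_one, one_mul] using this
  have h3 : ZMod.toCircle ((l.count (some (i, true)) : ℕ) : ZMod N) =
      ZMod.toCircle ((l.count (some (i, false)) : ℕ) : ZMod N) := by
    rw [← nsmul_one, ← nsmul_one, AddChar.map_nsmul_eq_pow, AddChar.map_nsmul_eq_pow]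
    ext
    exact_mod_cast h2
  have h4 := ZMod.injective_toCircle h3
  rw [ZMod.natCast_eq_natCast_iff', Nat.mod_eq_of_lt (List.count_le_length.trans_lt hN),
    Nat.mod_eq_of_lt (List.count_le_length.trans_lt hN)] at h4
  exact h h4

/-- The mean of the transforms of `a` under the `N`-torsion points of the gauge group that are
supported in `I`. -/
def gaugeAverage {ι A : Type*} [Fintype ι] [DecidableEq ι] [CStarAlgebra A]
    (α : (ι → Circle) → A →⋆ₐ[ℂ] A) (I : Finset ι) (N : ℕ) [NeZero N] : A →ₗ[ℂ] A :=
  ((N : ℂ) ^ Fintype.card ι)⁻¹ • ∑ j : ι → ZMod N, (α (gaugePoint I j)).toAlgHom.toLinearMap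

section Average

variable {ι A : Type*} [Fintype ι] [DecidableEq ι] [CStarAlgebra A]
    (α : (ι → Circle) → A →⋆ₐ[ℂ] A) (I : Finset ι)

theorem gaugeAverage_apply (N : ℕ) [NeZero N] (a : A) : gaugeAverage α I N a =
    ((N : ℂ) ^ Fintype.card ι)⁻¹ • ∑ j : ι → ZMod N, α (gaugePoint I j) a := by
  simp [gaugeAverage]

/-- This is a mean of `N ^ card ι` contractions; the indices outside `I` only repeat terms, which
the normalisation takes into account. -/
theorem norm_gaugeAverage_le (N : ℕ) [NeZero N] (a : A) : ‖gaugeAverage α I N a‖ ≤ ‖a‖ := by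
  rw [gaugeAverage_apply, norm_smul, norm_inv, norm_pow, Complex.norm_natCast,
    inv_mul_le_iff₀ (by have := NeZero.pos N; positivity)]
  refine (norm_sum_le_of_le _ fun j _ => NonUnitalStarAlgHom.norm_apply_le (α _) a).trans ?_
  simp

theorem gaugeAverage_of_fixed {N : ℕ} [NeZero N] {a : A}
    (h : ∀ j : ι → ZMod N, α (gaugePoint I j) a = a) : gaugeAverage α I N a = a := by
  have : (N : ℂ) ≠ 0 := NeZero.ne _
  simp [gaugeAverage_apply, h, ← Nat.cast_smul_eq_nsmul ℂ, smul_smul, this]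

/-- A faithfulness property of the averages, uniform in the order of the torsion points. -/
theorem exists_norm_le_mul_norm_gaugeAverage [PartialOrder A] [StarOrderedRing A] {a : A}
    (hc : Continuous fun z => α z a) (h1 : α 1 a = a) (ha : 0 ≤ a) :
    ∃ C, ∀ (N : ℕ) [NeZero N], ‖a‖ ≤ C * ‖gaugeAverage α I N a‖ := by
  by_cases h0 : a = 0
  · exact ⟨0, by simp [h0]⟩
  have := nontrivial_of_ne a 0 h0
  let s : (ι → ℝ) → ι → Circle := fun x i => Circle.exp (2 * Real.pi * x i)
  have hs : Continuous fun x => α (s x) a := hc.comp (by fun_prop)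
  have hs0 : s 0 = 1 := by ext i; simp [s]
  -- Within `δ` of the identity, a gauge transformation moves `a` by less than `‖a‖ / 2`.
  obtain ⟨δ, hδ, hδa⟩ := Metric.continuous_iff.1 hs 0 (‖a‖ / 2) (by positivity)
  obtain ⟨ε, hε, hεδ, hε1⟩ : ∃ ε, 0 < ε ∧ ε ≤ δ ∧ ε ≤ 1 :=
    ⟨min δ 1, by positivity, min_le_left _ _, min_le_right _ _⟩
  simp only [hs0, h1, dist_eq_norm, sub_zero] at hδa
  -- At least the proportion `ε ^ card ι` of the index tuples gives points near the identity. Each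
  -- of these contributes at least `a - ‖a‖ / 2` and all others contribute something positive, so
  -- the average has norm at least `ε ^ card ι * ‖a‖ / 2`.
  refine ⟨2 / ε ^ Fintype.card ι, fun N _ => ?_⟩
  have hN : (0 : ℝ) < N := by exact_mod_cast NeZero.pos N
  let T : Finset (ZMod N) := {k | (k.val : ℝ) < ε * N}
  have hT : ε * N ≤ T.card := by
    have h : (Finset.range ⌈ε * N⌉₊).card ≤ T.card := by
      -- The naturals below `⌈ε * N⌉₊` are those less than `ε * N`. Since `ε ≤ 1` they are less than
      -- `N`, hence have distinct residues.
      have hlt : ∀ k ∈ Finset.range ⌈ε * N⌉₊, k < N ∧ (k : ℝ) < ε * N := by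
        intro k hk
        have hk := Nat.lt_ceil.1 (Finset.mem_range.1 hk)
        refine ⟨?_, hk⟩
        exact_mod_cast hk.trans_le (mul_le_of_le_one_left hN.le hε1)
      refine Finset.card_le_card_of_injOn (fun k => (k : ZMod N)) ?_ ?_
      · intro k hk
        obtain ⟨h1, h2⟩ := hlt k hk
        simp only [T, Finset.coe_filter, Finset.mem_univ, true_and, Set.mem_ofPred_eq]
        rwa [ZMod.val_natCast_of_lt h1]
      · intro k hk l hl hkl
        have := (ZMod.natCast_eq_natCast_iff' k l N).1 hkl
        rwa [Nat.mod_eq_of_lt (hlt k hk).1, Nat.mod_eq_of_lt (hlt l hl).1] at this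
    rw [Finset.card_range] at h
    exact (Nat.le_ceil _).trans (by exact_mod_cast h)
  let G : Finset (ι → ZMod N) := Fintype.piFinset fun _ => T
  have hG : (ε * N) ^ Fintype.card ι ≤ G.card := by
    have h : G.card = T.card ^ Fintype.card ι := by simp [G]
    rw [h]
    push_cast
    gcongr
  have hnear : ∀ j ∈ G, a ≤ α (gaugePoint I j) a + algebraMap ℝ A (‖a‖ / 2) := by
    intro j hj
    let x : ι → ℝ := fun i => if i ∈ I then (j i).val / N else 0
    have hx : gaugePoint I j = s x := by
      ext i
      by_cases hi : i ∈ I <;> simp [gaugePoint, s, x, hi, ZMod.toCircle_eq_circleExp]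
    have hxn : ‖x‖ < δ := by
      rw [pi_norm_lt_iff hδ]
      intro i
      by_cases hi : i ∈ I
      · have := Fintype.mem_piFinset.1 hj i
        simp only [T, Finset.mem_filter, Finset.mem_univ, true_and] at this
        simp only [x, hi, if_true]
        rw [Real.norm_of_nonneg (by positivity), div_lt_iff₀ hN]
        exact this.trans_le (by gcongr)
      · simpa [x, hi] using hδ
    have hsa : IsSelfAdjoint (a - α (gaugePoint I j) a) :=
      ha.isSelfAdjoint.sub (ha.isSelfAdjoint.map _)
    rw [← sub_le_iff_le_add']
    refine hsa.le_algebraMap_norm_self.trans (algebraMap_le_algebraMap.2 ?_)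
    rw [norm_sub_rev, hx]
    exact (hδa x hxn).le
  have hpos : ∀ j : ι → ZMod N, 0 ≤ α (gaugePoint I j) a := fun j => map_nonneg _ ha
  set t := ∑ j : ι → ZMod N, α (gaugePoint I j) a with ht
  -- Sum over the nearby points only; the other summands of `t` are positive and can be dropped.
  have hsum : (G.card : ℝ) • a ≤ t + (G.card : ℝ) • algebraMap ℝ A (‖a‖ / 2) := by
    rw [Nat.cast_smul_eq_nsmul, Nat.cast_smul_eq_nsmul]
    calc G.card • a = ∑ j ∈ G, a := by simp
      _ ≤ ∑ j ∈ G, (α (gaugePoint I j) a + algebraMap ℝ A (‖a‖ / 2)) := Finset.sum_le_sum hnear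
      _ = ∑ j ∈ G, α (gaugePoint I j) a + G.card • algebraMap ℝ A (‖a‖ / 2) := by
        simp [Finset.sum_add_distrib]
      _ ≤ t + G.card • algebraMap ℝ A (‖a‖ / 2) := by
        gcongr
        exact Finset.sum_le_sum_of_subset_of_nonneg (Finset.subset_univ _) fun j _ _ => hpos j
  have hnorm := (CStarAlgebra.norm_le_norm_of_nonneg_of_le
    (smul_nonneg (Nat.cast_nonneg _) ha) hsum).trans (norm_add_le _ _)
  rw [norm_smul, norm_smul, norm_algebraMap', Real.norm_of_nonneg (Nat.cast_nonneg _),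
    Real.norm_of_nonneg (by positivity : (0 : ℝ) ≤ ‖a‖ / 2)] at hnorm
  have hav : ‖t‖ = N ^ Fintype.card ι * ‖gaugeAverage α I N a‖ := by
    rw [gaugeAverage_apply, norm_smul, norm_inv, norm_pow, Complex.norm_natCast, ← ht,
      mul_inv_cancel_left₀ (by positivity)]
  have h2 : (ε * N) ^ Fintype.card ι * ‖a‖ ≤
      2 * (N ^ Fintype.card ι * ‖gaugeAverage α I N a‖) := by
    rw [← hav]
    have := mul_le_mul_of_nonneg_right hG (norm_nonneg a)
    linarith
  rw [div_mul_eq_mul_div, le_div_iff₀ (by positivity)]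
  refine le_of_mul_le_mul_left ?_ (pow_pos hN (Fintype.card ι))
  rw [mul_pow] at h2
  linarith

end Average

/-- A family of gauge transformations `w i ↦ z i • w i`, `y ↦ y`. -/
structure IsGaugeAction {ι A : Type*} [CStarAlgebra A] (α : (ι → Circle) → A →⋆ₐ[ℂ] A)
    (w : ι → A) (y : A) : Prop where
  map_w : ∀ z i, α z (w i) = (z i : ℂ) • w i
  map_y : ∀ z, α z y = y

namespace IsGaugeAction

variable {ι : Type*} {A : Type} [CStarAlgebra A] {α : (ι → Circle) → A →⋆ₐ[ℂ] A} {w : ι → A} {y : A}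

theorem map_letter (hα : IsGaugeAction α w y) (z : ι → Circle) (x : Option (ι × Bool)) :
    α z (letter w y x) = letterPhase z x • letter w y x := by
  match x with
  | none => simp [letter, letterPhase, hα.map_y]
  | some (i, true) => simp [letter, letterPhase, hα.map_w]
  | some (i, false) => simp [letter, letterPhase, hα.map_w, map_star]

theorem map_prod (hα : IsGaugeAction α w y) (z : ι → Circle) (l : List (Option (ι × Bool))) :
    α z (l.map (letter w y)).prod = (l.map (letterPhase z)).prod • (l.map (letter w y)).prod := by
  induction l with
  | nil => simp
  | cons x l ih => simp [ih, hα.map_letter, smul_smul, mul_comm]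

/-- The average multiplies the word by the mean of a character of the group `ι → ZMod N`.
Translation by `k` multiplies the character sum by `χ k ≠ 1`, so the sum vanishes. -/
theorem gaugeAverage_prod_eq_zero [Fintype ι] [DecidableEq ι] (hα : IsGaugeAction α w y)
    {I : Finset ι} {i : ι} (hi : i ∈ I) {l : List (Option (ι × Bool))}
    (h : l.count (some (i, true)) ≠ l.count (some (i, false))) {N : ℕ} [NeZero N]
    (hN : l.length < N) : gaugeAverage α I N (l.map (letter w y)).prod = 0 := by
  have hne := prod_letterPhase_gaugePoint_ne_one hi h hN
  set k : ι → ZMod N := Pi.single i 1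
  set χ : (ι → ZMod N) → ℂ := fun j => (l.map (letterPhase (gaugePoint I j))).prod
  have hχ : ∑ j, χ j = 0 := by
    have h1 : ∑ j, χ j = (∑ j, χ j) * χ k := by
      rw [Finset.sum_mul, ← Equiv.sum_comp (Equiv.addRight k)]
      simp only [χ, Equiv.coe_addRight, gaugePoint_add, prod_letterPhase_mul]
    by_contra h0
    exact hne (mul_left_cancel₀ h0 (by rw [mul_one, ← h1]))
  rw [gaugeAverage_apply]
  simp only [hα.map_prod]
  rw [← Finset.sum_smul, hχ, zero_smul, smul_zero]

/-- For large `N`, the averages of a polynomial in the generators only involve the generators `w i`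
with `i ∈ I` through the products `w i * star (w i)`. -/
theorem eventually_gaugeAverage_mem [Fintype ι] [DecidableEq ι] (hα : IsGaugeAction α w y)
    (h : IsQuasiCommutingFamily w y) {I : Finset ι} {S : Subalgebra ℂ A} (hy : y ∈ S)
    (hI : ∀ i ∈ I, w i * star (w i) ∈ S) (hw : ∀ i ∉ I, w i ∈ S) (hw' : ∀ i ∉ I, star (w i) ∈ S)
    {p : A} (hp : p ∈ StarAlgebra.adjoin ℂ (insert y (Set.range w))) :
    ∀ᶠ N : ℕ in Filter.atTop, gaugeAverage α I (N + 1) p ∈ S := by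
  replace hp := h.adjoin_le_span_words hp
  induction hp using Submodule.span_induction with
  | mem x hx =>
    obtain ⟨l, rfl⟩ := hx
    -- The average has order `N + 1`, so `l.length ≤ N` makes the order exceed the length.
    filter_upwards [Filter.eventually_ge_atTop l.length] with N hN
    by_cases hl : ∀ i ∈ I, l.count (some (i, true)) = l.count (some (i, false))
    · rw [gaugeAverage_apply]
      simp only [hα.map_prod]
      rw [← Finset.sum_smul]
      have := h.prod_mem_of_count_eq hy hI hw hw' l hl
      exact S.smul_mem (S.smul_mem this _) _
    · push Not at hl
      obtain ⟨i, hi, hne⟩ := hl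
      rw [hα.gaugeAverage_prod_eq_zero hi hne (by omega)]
      exact S.zero_mem
  | zero => simp [S.zero_mem]
  | add x z _ _ hx hz =>
    filter_upwards [hx, hz] with N hx hz
    rw [map_add]
    exact S.add_mem hx hz
  | smul c x _ hx =>
    filter_upwards [hx] with N hx
    rw [map_smul]
    exact S.smul_mem hx c

/-- Orbits of generators are continuous, hence so are orbits of polynomials. As *-homomorphisms are
contractive, an approximation of `a` approximates its orbit uniformly. -/
theorem continuous_apply (hα : IsGaugeAction α w y)
    (hd : cstarGenerate (insert y (Set.range w)) = ⊤) (a : A) : Continuous fun z => α z a := by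
  have ha : a ∈ cstarGenerate (insert y (Set.range w)) := hd ▸ trivial
  have hdense : ∀ p ∈ StarAlgebra.adjoin ℂ (insert y (Set.range w)),
      Continuous fun z => α z p := by
    intro p hp
    induction hp using StarAlgebra.adjoin_induction with
    | mem x hx =>
      obtain rfl | ⟨i, rfl⟩ := hx
      · simpa only [hα.map_y] using continuous_const
      · simp only [hα.map_w]
        fun_prop
    | algebraMap r => simpa only [AlgHomClass.commutes] using continuous_const
    | add x y _ _ hx hy => simp only [map_add]; exact hx.add hy
    | mul x y _ _ hx hy => simp only [map_mul]; exact hx.mul hy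
    | star x _ hx => simpa only [map_star] using hx.star
  refine continuous_of_uniform_approx_of_continuous fun u hu => ?_
  obtain ⟨ε, hε, hεu⟩ := Metric.mem_uniformity_dist.1 hu
  obtain ⟨p, hp, hap⟩ := Metric.mem_closure_iff.1 ha ε hε
  refine ⟨fun z => α z p, hdense p hp, fun z => hεu ?_⟩
  rw [dist_eq_norm, ← map_sub]
  exact (NonUnitalStarAlgHom.norm_apply_le (α z) _).trans_lt (by rwa [← dist_eq_norm])

end IsGaugeAction

/-! ### Gauge actions on universal C*-algebras -/

namespace CStarRelations

variable {X : Type} (R : CStarRelations X)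

theorem cstarGenerate_range_gen : cstarGenerate (Set.range R.gen) = ⊤ := by
  refine eq_top_iff.2 fun u _ => ?_
  let v : R.Universal →⋆ₐ[ℂ] R.Product := (cstarGenerate (Set.range R.diag)).subtype
  have himg : v '' (StarAlgebra.adjoin ℂ (Set.range R.gen) : Set R.Universal) =
      (StarAlgebra.adjoin ℂ (Set.range R.diag) : Set R.Product) := by
    rw [← StarSubalgebra.coe_map, StarAlgHom.map_adjoin, ← Set.range_comp]
    rfl
  have hu : v u ∈ closure (StarAlgebra.adjoin ℂ (Set.range R.diag) : Set R.Product) := u.2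
  rw [← himg] at hu
  refine Metric.mem_closure_iff.2 fun ε hε => ?_
  obtain ⟨_, ⟨p, hp, rfl⟩, hup⟩ := Metric.mem_closure_iff.1 hu ε hε
  exact ⟨p, hp, hup⟩

/-- The homomorphism from the universal C*-algebra given by a family satisfying the relations. -/
def lift {B : Type} [CStarAlgebra B] (b : X → B) (hb : R.Holds b) : R.Universal →⋆ₐ[ℂ] B :=
  (R.existsUnique_lift b hb).exists.choose

theorem lift_gen {B : Type} [CStarAlgebra B] (b : X → B) (hb : R.Holds b) (x : X) :
    R.lift b hb (R.gen x) = b x :=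
  (R.existsUnique_lift b hb).exists.choose_spec x

end CStarRelations

theorem rho_ne_zero {m : ℕ} (θ : Matrix (Fin m) (Fin m) ℝ) (i j : Fin m) : rho θ i j ≠ 0 :=
  Complex.exp_ne_zero _

theorem rho_mul_star_rho {m : ℕ} (θ : Matrix (Fin m) (Fin m) ℝ) (i j : Fin m) :
    rho θ i j * star (rho θ i j) = 1 := by
  have h : 2 * Real.pi * Complex.I * θ i j = ((2 * Real.pi * θ i j : ℝ) : ℂ) * Complex.I := by
    push_cast
    ring
  rw [Complex.star_def, Complex.mul_conj, Complex.normSq_eq_norm_sq, rho, h,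
    Complex.norm_exp_ofReal_mul_I]
  simp

theorem Circle.coe_mul_star_coe (z : Circle) : (z : ℂ) * star (z : ℂ) = 1 := by
  simp [Complex.mul_conj]

namespace IsTorusFamily

variable {m : ℕ} {θ : Matrix (Fin m) (Fin m) ℝ} {A : Type*} [CStarAlgebra A] {U : Fin m → A}

theorem circle_smul (h : IsTorusFamily θ U) (z : Fin m → Circle) :
    IsTorusFamily θ fun i => (z i : ℂ) • U i where
  unitary i := by
    have hz := (z i).coe_mul_star_coe
    have h1 := Unitary.mem_iff.1 (h.unitary i)
    rw [Unitary.mem_iff, star_smul, smul_mul_smul_comm, smul_mul_smul_comm, h1.1, h1.2,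
      mul_comm (star _), hz, one_smul]
    exact ⟨rfl, rfl⟩
  comm i j := by
    rw [smul_mul_smul_comm, smul_mul_smul_comm, h.comm, smul_comm, mul_comm (z i : ℂ)]

theorem isQuasiCommutingFamily (h : IsTorusFamily θ U) : IsQuasiCommutingFamily U 1 where
  normal i := ⟨by
    have h1 := Unitary.mem_iff.1 (h.unitary i)
    rw [commute_iff_eq, h1.1, h1.2]⟩
  selfAdjoint := .one A
  comm i j := ⟨_, rho_ne_zero θ j i, h.comm i j⟩
  central i := Commute.one_left _

end IsTorusFamily

namespace IsBallFamily

variable {m : ℕ} {θ : Matrix (Fin m) (Fin m) ℝ} {A : Type*} [CStarAlgebra A] {w : Fin m → A}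
  {y : A}

theorem circle_smul (h : IsBallFamily θ w y) (z : Fin m → Circle) :
    IsBallFamily θ (fun i => (z i : ℂ) • w i) y where
  normal i := ⟨by
    have := (h.normal i).star_comm_self
    rw [star_smul]
    exact (this.smul_right _).smul_left _⟩
  positive := h.positive
  sphere := by
    rw [← h.sphere]
    congr 1
    refine Finset.sum_congr rfl fun i _ => ?_
    rw [star_smul, smul_mul_smul_comm, Circle.coe_mul_star_coe, one_smul]
  comm i j := by
    rw [smul_mul_smul_comm, smul_mul_smul_comm, h.comm, smul_comm, mul_comm (z i : ℂ)]
  central i := by rw [mul_smul_comm, smul_mul_assoc, h.central]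

theorem isQuasiCommutingFamily (h : IsBallFamily θ w y) : IsQuasiCommutingFamily w y where
  normal := h.normal
  selfAdjoint := h.star_y
  comm i j := ⟨_, rho_ne_zero θ j i, h.comm i j⟩
  central := h.central

/-- By Fuglede–Putnam, moving `w j` past `star (w i)` produces the conjugate of the scalar produced
by `w i`; the two cancel because `‖ρ‖ = 1`. -/
theorem commute_mul_star (h : IsBallFamily θ w y) (i j : Fin m) :
    Commute (w i * star (w i)) (w j) := by
  have hi := h.normal i
  have hr := rho_mul_star_rho θ j i
  have hn : IsStarNormal (star (rho θ j i) • w i) :=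
    ⟨by rw [star_smul]; exact (star_comm_self.smul_right _).smul_left _⟩
  have hs := fuglede_putnam_rosenblum (a := w i) (b := star (rho θ j i) • w i) (x := w j) hi hn
    (by rw [SemiconjBy, smul_mul_assoc, h.comm i j, smul_smul, mul_comm, hr, one_smul])
  rw [star_smul, star_star, SemiconjBy, smul_mul_assoc] at hs
  rw [commute_iff_eq, ← mul_assoc, ← one_smul ℂ (w j * w i), ← hr, mul_comm (rho θ j i),
    ← smul_smul, ← h.comm i j, smul_mul_assoc, mul_assoc (w i) (w j), hs, mul_smul_comm,
    smul_smul, mul_comm, hr, one_smul, mul_assoc]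

end IsBallFamily

/-- The gauge action on the deformed torus. -/
def torusGauge {m : ℕ} (θ : Matrix (Fin m) (Fin m) ℝ) (z : Fin m → Circle) :
    DeformedTorus θ →⋆ₐ[ℂ] DeformedTorus θ :=
  (torusRelations θ).lift (fun i => (z i : ℂ) • torusU θ i)
    ((isTorusFamily_torusU θ).circle_smul z)

theorem torusGauge_torusU {m : ℕ} (θ : Matrix (Fin m) (Fin m) ℝ) (z : Fin m → Circle)
    (i : Fin m) : torusGauge θ z (torusU θ i) = (z i : ℂ) • torusU θ i :=
  (torusRelations θ).lift_gen _ _ i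

theorem isGaugeAction_torusGauge {m : ℕ} (θ : Matrix (Fin m) (Fin m) ℝ) :
    IsGaugeAction (torusGauge θ) (torusU θ) 1 :=
  ⟨torusGauge_torusU θ, fun _ => map_one _⟩

theorem torusGauge_mul {m : ℕ} (θ : Matrix (Fin m) (Fin m) ℝ) (z z' : Fin m → Circle) :
    torusGauge θ (z * z') = (torusGauge θ z).comp (torusGauge θ z') :=
  (torusRelations θ).hom_ext fun i => by
    change torusGauge θ (z * z') (torusU θ i) = torusGauge θ z (torusGauge θ z' (torusU θ i))
    simp only [torusGauge_torusU, map_smul, smul_smul, Pi.mul_apply, Circle.coe_mul, mul_comm]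

/-- The generators `w i` of the deformed ball. -/
def ballW {m : ℕ} (θ : Matrix (Fin m) (Fin m) ℝ) (i : Fin m) : DeformedBall θ :=
  (ballRelations θ).gen (some i)

/-- The generator `y` of the deformed ball. -/
def ballY {m : ℕ} (θ : Matrix (Fin m) (Fin m) ℝ) : DeformedBall θ :=
  (ballRelations θ).gen none

theorem isBallFamily_ballW {m : ℕ} (θ : Matrix (Fin m) (Fin m) ℝ) :
    IsBallFamily θ (ballW θ) (ballY θ) :=
  isBallFamily_gen θ

theorem cstarGenerate_ball {m : ℕ} (θ : Matrix (Fin m) (Fin m) ℝ) :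
    cstarGenerate (insert (ballY θ) (Set.range (ballW θ))) = ⊤ := by
  rw [← (ballRelations θ).cstarGenerate_range_gen]
  congr 1
  exact (Option.range_eq _).symm

/-- The homomorphism from the deformed ball given by a family satisfying its relations. -/
def ballLift {m : ℕ} {θ : Matrix (Fin m) (Fin m) ℝ} {B : Type} [CStarAlgebra B] {w : Fin m → B}
    {y : B} (h : IsBallFamily θ w y) : DeformedBall θ →⋆ₐ[ℂ] B :=
  (ballRelations θ).lift (fun x => x.elim y w) h

theorem ballLift_ballW {m : ℕ} {θ : Matrix (Fin m) (Fin m) ℝ} {B : Type} [CStarAlgebra B]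
    {w : Fin m → B} {y : B} (h : IsBallFamily θ w y) (i : Fin m) :
    ballLift h (ballW θ i) = w i :=
  (ballRelations θ).lift_gen _ _ (some i)

theorem ballLift_ballY {m : ℕ} {θ : Matrix (Fin m) (Fin m) ℝ} {B : Type} [CStarAlgebra B]
    {w : Fin m → B} {y : B} (h : IsBallFamily θ w y) : ballLift h (ballY θ) = y :=
  (ballRelations θ).lift_gen _ _ none

theorem ball_hom_ext {m : ℕ} {θ : Matrix (Fin m) (Fin m) ℝ} {B : Type} [CStarAlgebra B]
    {φ ψ : DeformedBall θ →⋆ₐ[ℂ] B} (hw : ∀ i, φ (ballW θ i) = ψ (ballW θ i))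
    (hy : φ (ballY θ) = ψ (ballY θ)) : φ = ψ :=
  (ballRelations θ).hom_ext fun x => by
    cases x with
    | none => exact hy
    | some i => exact hw i

/-- The gauge action on the deformed ball. -/
def ballGauge {m : ℕ} (θ : Matrix (Fin m) (Fin m) ℝ) (z : Fin m → Circle) :
    DeformedBall θ →⋆ₐ[ℂ] DeformedBall θ :=
  ballLift ((isBallFamily_ballW θ).circle_smul z)

theorem isGaugeAction_ballGauge {m : ℕ} (θ : Matrix (Fin m) (Fin m) ℝ) :
    IsGaugeAction (ballGauge θ) (ballW θ) (ballY θ) :=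
  ⟨fun _ => ballLift_ballW _, fun _ => ballLift_ballY _⟩

theorem ballGauge_one {m : ℕ} (θ : Matrix (Fin m) (Fin m) ℝ) :
    ballGauge θ 1 = StarAlgHom.id ℂ (DeformedBall θ) :=
  ball_hom_ext (fun i => by simp [(isGaugeAction_ballGauge θ).map_w])
    (by simp [(isGaugeAction_ballGauge θ).map_y])

/-! ### Characters of commutative C*-subalgebras -/

/-- The norm of an element of a commutative C*-subalgebra is determined by the characters. -/
theorem norm_le_of_forall_character {B : Type} [CStarAlgebra B] {s : Set B}
    (hs : ∀ a ∈ s, ∀ b ∈ s, a * b = b * a) (hs' : ∀ a ∈ s, ∀ b ∈ s, a * star b = star b * a)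
    {u : cstarGenerate s} {C : ℝ} (hC : 0 ≤ C)
    (h : ∀ χ : cstarGenerate s →⋆ₐ[ℂ] ℂ, ‖χ u‖ ≤ C) : ‖u‖ ≤ C := by
  have hcomm : ∀ x y : cstarGenerate s, x * y = y * x := by
    have := StarAlgebra.isMulCommutative_adjoin ℂ hs hs'
    let _ := (StarAlgebra.adjoin ℂ s).commRingTopologicalClosure mul_comm'
    exact fun x y => mul_comm (G := (StarAlgebra.adjoin ℂ s).topologicalClosure) x y
  let _ : CommCStarAlgebra (cstarGenerate s) :=
    { (inferInstance : CStarAlgebra (cstarGenerate s)) with mul_comm := hcomm }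
  rw [← (gelfandTransform_isometry (cstarGenerate s)).norm_map_of_map_zero (map_zero _),
    ContinuousMap.norm_le _ hC]
  intro χ
  let χ' : cstarGenerate s →⋆ₐ[ℂ] ℂ :=
    { WeakDual.CharacterSpace.toAlgHom χ with map_star' := map_star χ }
  exact h χ'

/-- Characters are nonnegative at elements that are positive in the ambient algebra. -/
theorem exists_character_eq_ofReal {B : Type} [CStarAlgebra B] {Z : StarSubalgebra ℂ B}
    [hZ : IsClosed (Z : Set B)] (χ : Z →⋆ₐ[ℂ] ℂ) {u : Z} {b : B} (hu : (u : B) = star b * b) :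
    ∃ r : ℝ, 0 ≤ r ∧ χ u = r := by
  have h1 : χ u ∈ spectrum ℂ (u : B) := by
    -- Spectral permanence: the spectrum is the same in `Z` and in `B`, so it does not matter that
    -- `b` may lie outside `Z`.
    rw [← StarSubalgebra.spectrum_eq]
    exact AlgHom.apply_mem_spectrum χ u
  rw [hu, ← (IsSelfAdjoint.star_mul_self b).spectrumRestricts.algebraMap_image] at h1
  obtain ⟨r, hr, hr'⟩ := h1
  exact ⟨r, spectrum_star_mul_self_nonneg r hr, hr'.symm⟩

theorem hom_ext_cstarGenerate {A B : Type} [CStarAlgebra A] [CStarAlgebra B] {s : Set A}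
    {φ ψ : cstarGenerate s →⋆ₐ[ℂ] B} (h : ∀ x : cstarGenerate s, (x : A) ∈ s → φ x = ψ x) :
    φ = ψ := by
  refine StarAlgHom.ext_topologicalClosure (S := StarAlgebra.adjoin ℂ s) (map_continuous φ)
    (map_continuous ψ) ?_
  refine StarAlgHom.ext_adjoin ?_
  rintro x hx
  exact h _ hx

/-! ### The deformed ball as an algebra of functions on the octant -/

section BallMap

variable {m : ℕ} (θ : Matrix (Fin m) (Fin m) ℝ)

/-- The function `t ↦ t i • U i` on the octant. -/
def fieldW (i : Fin m) : C(sphereOctant m, DeformedTorus θ) where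
  toFun t := ((t.1 i.castSucc : ℝ) : ℂ) • torusU θ i
  continuous_toFun := by fun_prop

/-- The scalar function `t ↦ t (m + 1)` on the octant. -/
def fieldY : C(sphereOctant m, DeformedTorus θ) where
  toFun t := ((t.1 (Fin.last m) : ℝ) : ℂ) • 1
  continuous_toFun := by fun_prop

theorem sum_sq_add_sq_eq_one (t : sphereOctant m) :
    ∑ i : Fin m, t.1 i.castSucc ^ 2 + t.1 (Fin.last m) ^ 2 = 1 := by
  have h := mem_sphere_zero_iff_norm.1 t.2.1
  rw [← Fin.sum_univ_castSucc fun k => t.1 k ^ 2, ← EuclideanSpace.real_norm_sq_eq, h, one_pow]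

theorem fieldW_mul_star (i : Fin m) (t : sphereOctant m) :
    (fieldW θ i * star (fieldW θ i)) t = ((t.1 i.castSucc ^ 2 : ℝ) : ℂ) • 1 := by
  change (((t.1 i.castSucc : ℝ) : ℂ) • torusU θ i) * star (((t.1 i.castSucc : ℝ) : ℂ) • torusU θ i)
    = _
  rw [star_smul, smul_mul_smul_comm, (Unitary.mem_iff.1 ((isTorusFamily_torusU θ).unitary i)).2]
  simp [sq]

theorem isBallFamily_fieldW : IsBallFamily θ (fieldW θ) (fieldY θ) where
  normal i := ⟨by
    ext t
    have h := Unitary.mem_iff.1 ((isTorusFamily_torusU θ).unitary i)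
    change star (((t.1 i.castSucc : ℝ) : ℂ) • torusU θ i) * (((t.1 i.castSucc : ℝ) : ℂ) • torusU θ i)
      = (((t.1 i.castSucc : ℝ) : ℂ) • torusU θ i) * star (((t.1 i.castSucc : ℝ) : ℂ) • torusU θ i)
    rw [star_smul, smul_mul_smul_comm, smul_mul_smul_comm, h.1, h.2, mul_comm (star _)]⟩
  positive := by
    refine ⟨⟨fun t => ((√(t.1 (Fin.last m)) : ℝ) : ℂ) • 1, by fun_prop⟩, ?_⟩
    ext t
    change ((t.1 (Fin.last m) : ℝ) : ℂ) • (1 : DeformedTorus θ) =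
      star (((√(t.1 (Fin.last m)) : ℝ) : ℂ) • 1) * (((√(t.1 (Fin.last m)) : ℝ) : ℂ) • 1)
    rw [star_smul, star_one, smul_mul_smul_comm, one_mul, Complex.star_def, Complex.conj_ofReal,
      ← Complex.ofReal_mul, Real.mul_self_sqrt (t.2.2 _)]
  sphere := by
    ext t
    rw [ContinuousMap.add_apply, ContinuousMap.sum_apply]
    simp only [fieldW_mul_star]
    rw [← Finset.sum_smul]
    change _ + (((t.1 (Fin.last m) : ℝ) : ℂ) • (1 : DeformedTorus θ)) ^ 2 = 1
    rw [smul_pow, one_pow, ← add_smul]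
    have := sum_sq_add_sq_eq_one t
    rw [← Complex.ofReal_sum, ← Complex.ofReal_pow, ← Complex.ofReal_add, this, Complex.ofReal_one,
      one_smul]
  comm i j := by
    ext t
    change (((t.1 i.castSucc : ℝ) : ℂ) • torusU θ i) * (((t.1 j.castSucc : ℝ) : ℂ) • torusU θ j) =
      rho θ j i • ((((t.1 j.castSucc : ℝ) : ℂ) • torusU θ j) *
        (((t.1 i.castSucc : ℝ) : ℂ) • torusU θ i))
    rw [smul_mul_smul_comm, smul_mul_smul_comm, (isTorusFamily_torusU θ).comm, smul_comm,
      mul_comm ((t.1 i.castSucc : ℝ) : ℂ)]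
  central i := by
    ext t
    change (((t.1 (Fin.last m) : ℝ) : ℂ) • (1 : DeformedTorus θ)) *
      (((t.1 i.castSucc : ℝ) : ℂ) • torusU θ i) = (((t.1 i.castSucc : ℝ) : ℂ) • torusU θ i) *
      (((t.1 (Fin.last m) : ℝ) : ℂ) • (1 : DeformedTorus θ))
    simp [smul_smul, mul_comm]

/-- The canonical homomorphism from the deformed ball to functions on the octant. -/
def ballMap : DeformedBall θ →⋆ₐ[ℂ] C(sphereOctant m, DeformedTorus θ) :=
  ballLift (isBallFamily_fieldW θ)

theorem ballMap_ballW (i : Fin m) : ballMap θ (ballW θ i) = fieldW θ i := ballLift_ballW _ i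

theorem ballMap_ballY : ballMap θ (ballY θ) = fieldY θ := ballLift_ballY _

/-- The value of the canonical homomorphism at a point of the octant. -/
def ballEval (t : sphereOctant m) : DeformedBall θ →⋆ₐ[ℂ] DeformedTorus θ where
  toFun u := ballMap θ u t
  map_one' := by simp
  map_mul' _ _ := by simp
  map_zero' := by simp
  map_add' _ _ := by simp
  commutes' r := by rw [AlgHomClass.commutes]; rfl
  map_star' _ := by rw [map_star]; rfl

theorem ballEval_apply (t : sphereOctant m) (u : DeformedBall θ) :
    ballEval θ t u = ballMap θ u t := rfl

theorem ballEval_ballW (t : sphereOctant m) (i : Fin m) :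
    ballEval θ t (ballW θ i) = ((t.1 i.castSucc : ℝ) : ℂ) • torusU θ i := by
  rw [ballEval_apply, ballMap_ballW]; rfl

theorem ballEval_ballY (t : sphereOctant m) :
    ballEval θ t (ballY θ) = ((t.1 (Fin.last m) : ℝ) : ℂ) • 1 := by
  rw [ballEval_apply, ballMap_ballY]; rfl

theorem ballEval_ballW_mul_star (t : sphereOctant m) (i : Fin m) :
    ballEval θ t (ballW θ i * star (ballW θ i)) = ((t.1 i.castSucc ^ 2 : ℝ) : ℂ) • 1 := by
  rw [ballEval_apply, map_mul, map_star, ballMap_ballW, fieldW_mul_star]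

/-- A rotation of `w i` becomes the same rotation of `U i`, and the scalars `t i` are unaffected.
Hence the kernel of `ballMap` is stable under the gauge action and under averages. -/
theorem ballEval_ballGauge (t : sphereOctant m) (z : Fin m → Circle) (u : DeformedBall θ) :
    ballEval θ t (ballGauge θ z u) = torusGauge θ z (ballEval θ t u) := by
  refine DFunLike.congr_fun (f := (ballEval θ t).comp (ballGauge θ z))
    (g := (torusGauge θ z).comp (ballEval θ t)) (ball_hom_ext (fun i => ?_) ?_) u
  · simp only [StarAlgHom.comp_apply, (isGaugeAction_ballGauge θ).map_w, map_smul, ballEval_ballW,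
      torusGauge_torusU, smul_smul, mul_comm]
  · simp only [StarAlgHom.comp_apply, (isGaugeAction_ballGauge θ).map_y, map_smul, ballEval_ballY,
      map_one]

theorem ballMap_gaugeAverage_eq_zero (I : Finset (Fin m)) (N : ℕ) [NeZero N] {u : DeformedBall θ}
    (hu : ballMap θ u = 0) : ballMap θ (gaugeAverage (ballGauge θ) I N u) = 0 := by
  ext t
  have h : ∀ z, ballEval θ t (ballGauge θ z u) = 0 := fun z => by
    rw [ballEval_ballGauge, ballEval_apply, hu, ContinuousMap.zero_apply, map_zero]
  rw [← ballEval_apply, gaugeAverage_apply, map_smul, map_sum]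
  simp only [h, Finset.sum_const_zero, smul_zero, ContinuousMap.zero_apply]

/-! ### Injectivity -/

/-- The generators of the gauge-invariant part of the deformed ball. -/
def ballInvariants : Set (DeformedBall θ) :=
  insert (ballY θ) (Set.range fun i => ballW θ i * star (ballW θ i))

theorem commute_ballInvariants {a b : DeformedBall θ} (ha : a ∈ ballInvariants θ)
    (hb : b ∈ ballInvariants θ) : Commute a b := by
  have h := (isBallFamily_ballW θ).isQuasiCommutingFamily
  have hy : ∀ i, Commute (ballY θ) (ballW θ i * star (ballW θ i)) := fun i =>
    (h.central i).mul_right (h.central_star i)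
  obtain rfl | ⟨i, rfl⟩ := ha <;> obtain rfl | ⟨j, rfl⟩ := hb
  · exact Commute.refl _
  · exact hy j
  · exact (hy i).symm
  · have key := (isBallFamily_ballW θ).commute_mul_star
    have hsa : star (ballW θ i * star (ballW θ i)) = ballW θ i * star (ballW θ i) := by simp
    have h2 := (key i j).star_star
    rw [hsa] at h2
    exact (key i j).mul_right h2

theorem isSelfAdjoint_of_mem_ballInvariants {a : DeformedBall θ} (ha : a ∈ ballInvariants θ) :
    IsSelfAdjoint a := by
  obtain rfl | ⟨i, rfl⟩ := ha
  · exact (isBallFamily_ballW θ).star_y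
  · exact IsSelfAdjoint.mul_star_self _

/-- Every character of the gauge-invariant part is evaluation at a point of the octant. -/
theorem exists_ballEval_eq_character (χ : cstarGenerate (ballInvariants θ) →⋆ₐ[ℂ] ℂ) :
    ∃ t, ∀ u : cstarGenerate (ballInvariants θ), ballEval θ t u = χ u • 1 := by
  have hmem : ∀ a ∈ ballInvariants θ, a ∈ cstarGenerate (ballInvariants θ) := fun a ha =>
    StarSubalgebra.le_topologicalClosure _ (StarAlgebra.subset_adjoin ℂ _ ha)
  let gy : cstarGenerate (ballInvariants θ) := ⟨ballY θ, hmem _ (Set.mem_insert _ _)⟩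
  let gw : Fin m → cstarGenerate (ballInvariants θ) := fun i =>
    ⟨ballW θ i * star (ballW θ i), hmem _ (Set.mem_insert_of_mem _ ⟨i, rfl⟩)⟩
  obtain ⟨s, hs, hχs⟩ : ∃ s : ℝ, 0 ≤ s ∧ χ gy = s := by
    obtain ⟨b, hb⟩ := (isBallFamily_ballW θ).positive
    exact exists_character_eq_ofReal χ hb
  have hw : ∀ i, ∃ r : ℝ, 0 ≤ r ∧ χ (gw i) = r := fun i =>
    exists_character_eq_ofReal χ (b := star (ballW θ i)) (by rw [star_star])
  choose r hr hχr using hw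
  have hsum : ∑ i, r i + s ^ 2 = 1 := by
    have h1 : ∑ i, gw i + gy ^ 2 = 1 := by
      refine Subtype.ext ?_
      simpa [gw, gy] using (isBallFamily_ballW θ).sphere
    have h2 := congrArg χ h1
    rw [map_add, map_sum, map_pow, map_one, hχs] at h2
    simp only [hχr] at h2
    exact_mod_cast h2
  -- A square root is taken only for the first `m` coordinates, since `r i` is the value at `w i *
  -- star (w i)` while `s` is the value at `y` itself. The sphere relation puts the point on the
  -- unit sphere.
  let t : EuclideanSpace ℝ (Fin (m + 1)) := WithLp.toLp 2 (Fin.snoc (fun i => √(r i)) s)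
  have ht1 : ∀ i : Fin m, t i.castSucc = √(r i) := fun i => by simp [t]
  have ht2 : t (Fin.last m) = s := by simp [t]
  have ht : t ∈ sphereOctant m := by
    refine ⟨mem_sphere_zero_iff_norm.2 ?_, fun k => ?_⟩
    · rw [← sq_eq_sq₀ (norm_nonneg _) zero_le_one, EuclideanSpace.real_norm_sq_eq,
        Fin.sum_univ_castSucc, one_pow, ← hsum]
      simp only [ht1, ht2, Real.sq_sqrt (hr _)]
    · refine Fin.lastCases ?_ (fun i => ?_) k
      · rwa [ht2]
      · rw [ht1]
        positivity
  refine ⟨⟨t, ht⟩, fun u => ?_⟩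
  rw [← Algebra.algebraMap_eq_smul_one]
  refine DFunLike.congr_fun
    (f := (ballEval θ ⟨t, ht⟩).comp (cstarGenerate (ballInvariants θ)).subtype)
    (g := (StarAlgHom.ofId ℂ (DeformedTorus θ)).comp χ) (hom_ext_cstarGenerate ?_) u
  rintro ⟨_, _⟩ (h | ⟨i, h⟩)
  · subst h
    change ballEval θ ⟨t, ht⟩ (ballY θ) = algebraMap ℂ _ (χ gy)
    rw [ballEval_ballY, hχs, Algebra.algebraMap_eq_smul_one, ht2]
  · subst h
    change ballEval θ ⟨t, ht⟩ (ballW θ i * star (ballW θ i)) = algebraMap ℂ _ (χ (gw i))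
    rw [ballEval_ballW_mul_star, hχr, Algebra.algebraMap_eq_smul_one, ht1, Real.sq_sqrt (hr i)]

/-- The norm is determined by characters, every character is evaluation at a point of the octant,
and `‖1‖ = 1` in `A_θ`. -/
theorem norm_le_norm_ballMap [Nontrivial (DeformedTorus θ)] {u : DeformedBall θ}
    (hu : u ∈ cstarGenerate (ballInvariants θ)) : ‖u‖ ≤ ‖ballMap θ u‖ := by
  refine norm_le_of_forall_character (u := ⟨u, hu⟩)
    (fun a ha b hb => commute_ballInvariants θ ha hb) (fun a ha b hb => ?_) (norm_nonneg _)
    fun χ => ?_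
  · rw [(isSelfAdjoint_of_mem_ballInvariants θ hb).star_eq]
    exact commute_ballInvariants θ ha hb
  · obtain ⟨t, ht⟩ := exists_ballEval_eq_character θ χ
    have h : ‖χ ⟨u, hu⟩‖ = ‖ballEval θ t u‖ := by rw [ht ⟨u, hu⟩, norm_smul, norm_one, mul_one]
    rw [h]
    exact (ballMap θ u).norm_coe_le_norm t

/-- Approximate `b = star a * a` in the kernel by a polynomial `p`. For suitable `N` the average `E
p` is invariant, so its norm can be read off from its image, which is small because `E b` lies in
the kernel. Hence `E b` is small. As `N` depends on the approximation, a bound on `‖b‖` requires the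
constant `C` to be uniform in `N`. -/
theorem ballMap_injective [Nontrivial (DeformedTorus θ)] : Function.Injective (ballMap θ) := by
  let _ := CStarAlgebra.spectralOrder (DeformedBall θ)
  have := CStarAlgebra.spectralOrderedRing (DeformedBall θ)
  rw [injective_iff_map_eq_zero]
  intro a ha
  set b := star a * a with hb
  have hb0 : ballMap θ b = 0 := by rw [hb, map_mul, ha, mul_zero]
  have hα := isGaugeAction_ballGauge θ
  obtain ⟨C, hC⟩ := exists_norm_le_mul_norm_gaugeAverage (ballGauge θ) Finset.univ
    (hα.continuous_apply (cstarGenerate_ball θ) b) (by rw [ballGauge_one]; rfl)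
    (star_mul_self_nonneg a)
  have hsmall : ∀ ε > 0, ∃ N : ℕ, ‖gaugeAverage (ballGauge θ) Finset.univ (N + 1) b‖ ≤ 2 * ε := by
    intro ε hε
    have hmem : b ∈ cstarGenerate (insert (ballY θ) (Set.range (ballW θ))) :=
      cstarGenerate_ball θ ▸ trivial
    obtain ⟨p, hp, hbp⟩ := Metric.mem_closure_iff.1 hmem ε hε
    rw [dist_eq_norm] at hbp
    have hsub : ∀ a ∈ ballInvariants θ, a ∈ cstarGenerate (ballInvariants θ) := fun a ha =>
      StarSubalgebra.le_topologicalClosure _ (StarAlgebra.subset_adjoin ℂ _ ha)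
    obtain ⟨N, hN⟩ := (hα.eventually_gaugeAverage_mem
      (isBallFamily_ballW θ).isQuasiCommutingFamily (I := Finset.univ)
      (S := (cstarGenerate (ballInvariants θ)).toSubalgebra) (hsub _ (Set.mem_insert _ _))
      (fun i _ => hsub _ (Set.mem_insert_of_mem _ ⟨i, rfl⟩)) (by simp) (by simp) hp).exists
    refine ⟨N, ?_⟩
    set E := gaugeAverage (ballGauge θ) Finset.univ (N + 1) with hE
    have h1 : ‖E (b - p)‖ ≤ ε := (norm_gaugeAverage_le _ _ _ _).trans hbp.le
    have h2 : ‖E p‖ ≤ ε := by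
      refine (norm_le_norm_ballMap θ hN).trans ?_
      have h3 : ballMap θ (E p) = -ballMap θ (E (b - p)) := by
        rw [map_sub E, map_sub (ballMap θ), hE, ballMap_gaugeAverage_eq_zero θ _ _ hb0]
        simp
      rw [h3, norm_neg]
      exact (NonUnitalStarAlgHom.norm_apply_le (ballMap θ) _).trans h1
    calc ‖E b‖ = ‖E (b - p) + E p‖ := by rw [← map_add, sub_add_cancel]
      _ ≤ ‖E (b - p)‖ + ‖E p‖ := norm_add_le _ _
      _ ≤ 2 * ε := by linarith
  have hbz : ‖b‖ ≤ 0 := by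
    refine le_of_forall_pos_le_add fun δ hδ => ?_
    -- The choice turns `C * (2 * ε)` into at most `δ`; `|C| + 1` is used because the sign of `C` is
    -- not known.
    obtain ⟨N, hN⟩ := hsmall (δ / (2 * (|C| + 1))) (by positivity)
    refine (hC (N + 1)).trans ?_
    calc C * ‖gaugeAverage (ballGauge θ) Finset.univ (N + 1) b‖
        ≤ (|C| + 1) * ‖gaugeAverage (ballGauge θ) Finset.univ (N + 1) b‖ := by
          gcongr
          linarith [le_abs_self C]
      _ ≤ (|C| + 1) * (2 * (δ / (2 * (|C| + 1)))) := by gcongr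
      _ = 0 + δ := by field_simp; ring
  rw [norm_le_zero_iff] at hbz
  exact CStarRing.star_mul_self_eq_zero_iff a |>.1 hbz

end BallMap

/-! ### Intersections of faces of the deformed torus -/

theorem subset_cstarGenerate {A : Type} [CStarAlgebra A] (s : Set A) :
    s ⊆ (cstarGenerate s : Set A) :=
  (StarAlgebra.subset_adjoin ℂ s).trans (StarSubalgebra.le_topologicalClosure _)

theorem cstarGenerate_le {A : Type} [CStarAlgebra A] {s : Set A} {S : StarSubalgebra ℂ A}
    (hS : IsClosed (S : Set A)) (h : s ⊆ S) : cstarGenerate s ≤ S :=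
  StarSubalgebra.topologicalClosure_minimal (StarAlgebra.adjoin_le h) hS

section Face

variable {m : ℕ} (θ : Matrix (Fin m) (Fin m) ℝ)

theorem cstarGenerate_torus : cstarGenerate (insert 1 (Set.range (torusU θ))) = ⊤ := by
  refine top_le_iff.1 ?_
  rw [← (torusRelations θ).cstarGenerate_range_gen]
  exact cstarGenerate_le (isClosed_cstarGenerate _)
    ((Set.subset_insert _ _).trans (subset_cstarGenerate _))

theorem torusGauge_one : torusGauge θ 1 = StarAlgHom.id ℂ (DeformedTorus θ) :=
  (torusRelations θ).hom_ext fun i => by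
    change torusGauge θ 1 (torusU θ i) = torusU θ i
    simp [torusGauge_torusU]

theorem torusGauge_mulSingle_of_mem_torusFace {i : Fin m} {a : DeformedTorus θ}
    (ha : a ∈ torusFace θ i) (z : Circle) : torusGauge θ (Pi.mulSingle i z) a = a := by
  refine DFunLike.congr_fun (f := (torusGauge θ (Pi.mulSingle i z)).comp (torusFace θ i).subtype)
    (g := (torusFace θ i).subtype) (hom_ext_cstarGenerate ?_) ⟨a, ha⟩
  rintro ⟨_, _⟩ ⟨j, hj, rfl⟩
  change torusGauge θ (Pi.mulSingle i z) (torusU θ j) = torusU θ j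
  rw [torusGauge_torusU, Pi.mulSingle_eq_of_ne hj, Circle.coe_one, one_smul]

/-- The gauge point is a product of rotations of single coordinates `i ∈ I`, and each of these fixes
every generator of `A_θ(i)`. -/
theorem torusGauge_gaugePoint_of_mem_torusFace {I : Finset (Fin m)} {a : DeformedTorus θ}
    (ha : ∀ i ∈ I, a ∈ torusFace θ i) {N : ℕ} [NeZero N] (j : Fin m → ZMod N) :
    torusGauge θ (gaugePoint I j) a = a := by
  induction I using Finset.induction_on with
  | empty =>
    have : gaugePoint ∅ j = 1 := by ext i; simp [gaugePoint]
    rw [this, torusGauge_one]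
    rfl
  | insert i I hi ih =>
    have : gaugePoint (insert i I) j =
        Pi.mulSingle i (ZMod.toCircle (j i)) * gaugePoint I j := by
      ext k
      by_cases hk : k = i
      · subst hk; simp [gaugePoint, hi]
      · simp [gaugePoint, hk]
    rw [this, torusGauge_mul, StarAlgHom.comp_apply,
      ih fun k hk => ha k (Finset.mem_insert_of_mem hk),
      torusGauge_mulSingle_of_mem_torusFace θ (ha i (Finset.mem_insert_self _ _))]

/-- An intersection of faces is generated by the generators common to them. -/
theorem mem_cstarGenerate_of_forall_mem_torusFace {I : Finset (Fin m)} {a : DeformedTorus θ}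
    (ha : ∀ i ∈ I, a ∈ torusFace θ i) : a ∈ cstarGenerate (torusU θ '' {j | j ∉ I}) := by
  refine (isClosed_cstarGenerate _).closure_subset (Metric.mem_closure_iff.2 fun ε hε => ?_)
  have hmem : a ∈ cstarGenerate (insert 1 (Set.range (torusU θ))) :=
    cstarGenerate_torus θ ▸ trivial
  obtain ⟨p, hp, hap⟩ := Metric.mem_closure_iff.1 hmem ε hε
  have hU : ∀ i ∉ I, torusU θ i ∈ cstarGenerate (torusU θ '' {j | j ∉ I}) := fun i hi =>
    subset_cstarGenerate _ ⟨i, hi, rfl⟩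
  -- Since `U i * star (U i) = 1`, a word balanced in `I` reduces to one without letters from `I`.
  obtain ⟨N, hN⟩ := ((isGaugeAction_torusGauge θ).eventually_gaugeAverage_mem
    (isTorusFamily_torusU θ).isQuasiCommutingFamily (I := I)
    (S := (cstarGenerate (torusU θ '' {j | j ∉ I})).toSubalgebra) (Subalgebra.one_mem _)
    (fun i _ => by
      rw [(Unitary.mem_iff.1 ((isTorusFamily_torusU θ).unitary i)).2]
      exact Subalgebra.one_mem _)
    hU (fun i hi => (cstarGenerate _).star_mem' (hU i hi)) hp).exists
  refine ⟨_, hN, ?_⟩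
  rw [dist_eq_norm] at hap ⊢
  -- The averages fix `a`, so the distance from `a` to the average of `p` is at most that from `a`
  -- to `p`.
  rw [← gaugeAverage_of_fixed (torusGauge θ) I (N := N + 1)
    (torusGauge_gaugePoint_of_mem_torusFace θ ha), ← map_sub]
  exact (norm_gaugeAverage_le _ _ _ _).trans_lt hap

/-! ### The range of the canonical homomorphism -/

theorem ballMap_mem_fieldAlgebra (u : DeformedBall θ) : ballMap θ u ∈ fieldAlgebra θ := by
  have h : cstarGenerate (insert (ballY θ) (Set.range (ballW θ))) ≤
      (fieldAlgebra θ).comap (ballMap θ) := by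
    refine cstarGenerate_le ((isClosed_fieldAlgebra θ).preimage (map_continuous (ballMap θ))) ?_
    rintro _ (rfl | ⟨i, rfl⟩) k t ht
    · change ballEval θ t (ballY θ) ∈ torusFace θ k
      rw [ballEval_ballY]
      exact SMulMemClass.smul_mem _ (one_mem _)
    · change ballEval θ t (ballW θ i) ∈ torusFace θ k
      rw [ballEval_ballW]
      by_cases hik : i = k
      -- The only generator whose value could leave `A_θ(k)` is `w k`, and it vanishes where `t k =
      -- 0`.
      · rw [hik, ht, Complex.ofReal_zero, zero_smul]
        exact zero_mem _
      · exact SMulMemClass.smul_mem _ (subset_cstarGenerate _ ⟨i, hik, rfl⟩)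
  exact h (cstarGenerate_ball θ ▸ trivial : u ∈ _)

theorem isClosed_range_ballMap [Nontrivial (DeformedTorus θ)] :
    IsClosed ((ballMap θ).range : Set C(sphereOctant m, DeformedTorus θ)) :=
  (NonUnitalStarAlgHom.isometry (ballMap θ)
    (ballMap_injective θ)).isClosedEmbedding.isClosed_range

/-- Scalar functions on the octant as functions with values in the deformed torus. -/
def scalarField : C(sphereOctant m, ℂ) →⋆ₐ[ℂ] C(sphereOctant m, DeformedTorus θ) :=
  ContinuousMap.compStarAlgHom _ (StarAlgHom.ofId ℂ (DeformedTorus θ)) (algebraMapCLM ℂ _).continuous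

theorem scalarField_apply (g : C(sphereOctant m, ℂ)) (t : sphereOctant m) :
    scalarField θ g t = g t • 1 := by
  change algebraMap ℂ (DeformedTorus θ) (g t) = g t • 1
  exact Algebra.algebraMap_eq_smul_one _

/-- Stone–Weierstrass for the functions `t (m + 1)` and `(t i) ^ 2`, the images of `y` and `w i *
star (w i)`. The squares suffice to separate points because coordinates on the octant are
nonnegative. -/
theorem scalarField_mem_range [Nontrivial (DeformedTorus θ)] (g : C(sphereOctant m, ℂ)) :
    scalarField θ g ∈ (ballMap θ).range := by
  let K : StarSubalgebra ℂ C(sphereOctant m, ℂ) := (ballMap θ).range.comap (scalarField θ)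
  have hK : IsClosed (K : Set C(sphereOctant m, ℂ)) :=
    (isClosed_range_ballMap θ).preimage (map_continuous (scalarField θ))
  let cy : C(sphereOctant m, ℂ) := ⟨fun t => ((t.1 (Fin.last m) : ℝ) : ℂ), by fun_prop⟩
  let cw (i : Fin m) : C(sphereOctant m, ℂ) :=
    ⟨fun t => ((t.1 i.castSucc ^ 2 : ℝ) : ℂ), by fun_prop⟩
  have hy : cy ∈ K := by
    change scalarField θ cy ∈ (ballMap θ).range
    refine ⟨ballY θ, ?_⟩
    ext t
    exact (ballEval_ballY θ t).trans (scalarField_apply θ cy t).symm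
  have hw : ∀ i : Fin m, cw i ∈ K := by
    intro i
    change scalarField θ (cw i) ∈ (ballMap θ).range
    refine ⟨ballW θ i * star (ballW θ i), ?_⟩
    ext t
    exact (ballEval_ballW_mul_star θ t i).trans (scalarField_apply θ (cw i) t).symm
  have hsep : K.SeparatesPoints := by
    intro s t hst
    by_contra! hall
    refine hst (Subtype.ext (PiLp.ext fun k => ?_))
    refine Fin.lastCases ?_ (fun i => ?_) k
    · exact Complex.ofReal_injective (hall _ ⟨_, hy, rfl⟩)
    · have := Complex.ofReal_injective (hall _ ⟨_, hw i, rfl⟩)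
      exact (sq_eq_sq₀ (s.2.2 _) (t.2.2 _)).1 this
  have htop := ContinuousMap.starSubalgebra_topologicalClosure_eq_top_of_separatesPoints K hsep
  have hg : g ∈ K.topologicalClosure := htop ▸ trivial
  exact hK.closure_subset hg

/-- If `t j ≠ 0`, then `(t j)⁻¹ • w j` evaluates to `U j`. The value `f t` lies in all faces with `t
i = 0`, hence in the algebra generated by exactly these `U j`. -/
theorem exists_norm_ballEval_sub_lt {f : C(sphereOctant m, DeformedTorus θ)}
    (hf : f ∈ fieldAlgebra θ) (t : sphereOctant m) {ε : ℝ} (hε : 0 < ε) :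
    ∃ u, ‖ballMap θ u t - f t‖ < ε := by
  have hmem := mem_cstarGenerate_of_forall_mem_torusFace θ
    (I := Finset.univ.filter fun i : Fin m => t.1 i.castSucc = 0) (a := f t)
    fun i hi => hf i t (by simpa using hi)
  obtain ⟨p, hp, hap⟩ := Metric.mem_closure_iff.1 hmem ε hε
  have hle : StarAlgebra.adjoin ℂ (torusU θ ''
      {j | j ∉ Finset.univ.filter fun i : Fin m => t.1 i.castSucc = 0}) ≤
      (ballEval θ t).range := by
    refine StarAlgebra.adjoin_le ?_
    rintro _ ⟨j, hj, rfl⟩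
    have hj : ((t.1 j.castSucc : ℝ) : ℂ) ≠ 0 := by simpa using hj
    refine ⟨((t.1 j.castSucc : ℝ) : ℂ)⁻¹ • ballW θ j, ?_⟩
    change ballEval θ t _ = _
    rw [map_smul, ballEval_ballW, smul_smul, inv_mul_cancel₀ hj, one_smul]
  obtain ⟨u, rfl⟩ := hle hp
  refine ⟨u, ?_⟩
  rw [norm_sub_rev, ← dist_eq_norm]
  exact hap

/-- The pointwise approximants stay good on open neighbourhoods. Finitely many of these cover the
compact octant, and a partition of unity glues the approximants within the range, since its members
are scalar functions and lie in the range too. -/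
theorem mem_range_ballMap [Nontrivial (DeformedTorus θ)]
    {f : C(sphereOctant m, DeformedTorus θ)} (hf : f ∈ fieldAlgebra θ) :
    f ∈ (ballMap θ).range := by
  refine (isClosed_range_ballMap θ).closure_subset (Metric.mem_closure_iff.2 fun ε hε => ?_)
  choose u hu using fun t => exists_norm_ballEval_sub_lt θ hf t (half_pos hε)
  let V : sphereOctant m → Set (sphereOctant m) := fun t =>
    {s | ‖ballMap θ (u t) s - f s‖ < ε / 2}
  have hV : ∀ t, IsOpen (V t) := fun t => isOpen_lt (by fun_prop) continuous_const
  obtain ⟨T, hT⟩ := isCompact_univ.elim_nhds_subcover V fun t _ => (hV t).mem_nhds (hu t)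
  obtain ⟨χ, hχ⟩ := PartitionOfUnity.exists_isSubordinate isClosed_univ (fun t : T => V t)
    (fun t => hV t) fun s hs => by
      obtain ⟨t, ht, hst⟩ := Set.mem_iUnion₂.1 (hT.2 hs)
      exact Set.mem_iUnion.2 ⟨⟨t, ht⟩, hst⟩
  let c : T → C(sphereOctant m, ℂ) := fun t => ⟨fun s => (χ t s : ℂ), by fun_prop⟩
  refine ⟨∑ t : T, scalarField θ (c t) * ballMap θ (u t), sum_mem fun t _ =>
    mul_mem (scalarField_mem_range θ _) ⟨_, rfl⟩, ?_⟩
  rw [dist_comm, dist_eq_norm]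
  refine lt_of_le_of_lt ((ContinuousMap.norm_le _ (half_pos hε).le).2 fun s => ?_) (half_lt_self hε)
  have h1 : ∑ t : T, χ t s = 1 := by
    rw [← finsum_eq_sum_of_fintype]
    exact χ.sum_eq_one (Set.mem_univ s)
  have h2 : (∑ t : T, scalarField θ (c t) * ballMap θ (u t) - f) s =
      ∑ t : T, (χ t s : ℂ) • (ballMap θ (u t) s - f s) := by
    have h3 : ∑ t : T, (χ t s : ℂ) = 1 := by exact_mod_cast h1
    simp only [smul_sub, Finset.sum_sub_distrib]
    rw [← Finset.sum_smul, h3, one_smul, ContinuousMap.sub_apply, ContinuousMap.sum_apply]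
    congr 1
    refine Finset.sum_congr rfl fun t _ => ?_
    rw [ContinuousMap.mul_apply, scalarField_apply, smul_mul_assoc, one_mul]
    rfl
  rw [h2]
  calc ‖∑ t : T, (χ t s : ℂ) • (ballMap θ (u t) s - f s)‖ ≤ ∑ t : T, χ t s * (ε / 2) := by
        refine norm_sum_le_of_le _ fun t _ => ?_
        rw [norm_smul, Complex.norm_real, Real.norm_of_nonneg (χ.nonneg t s)]
        by_cases h0 : χ t s = 0
        · simp [h0]
        · have hs : s ∈ V t := hχ t (subset_tsupport _ h0)
          exact mul_le_mul_of_nonneg_left (le_of_lt hs) (χ.nonneg t s)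
    _ = ε / 2 := by rw [← Finset.sum_mul, h1, one_mul]

end Face

end

theorem theorem1p6 (m : ℕ) (θ : Matrix (Fin m) (Fin m) ℝ) (hθ : θᵀ = -θ) :
    Nonempty (DeformedBall θ ≃⋆ₐ[ℂ] fieldAlgebra θ) := by
  have := nontrivial_deformedTorus θ hθ
  let φ := (ballMap θ).codRestrict (fieldAlgebra θ) (ballMap_mem_fieldAlgebra θ)
  refine ⟨StarAlgEquiv.ofBijective φ ⟨?_, ?_⟩⟩
  · exact ((ballMap θ).injective_codRestrict _ _).2 (ballMap_injective θ)
  · rintro ⟨f, hf⟩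
    obtain ⟨u, hu⟩ := mem_range_ballMap θ hf
    exact ⟨u, Subtype.ext hu⟩
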